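/- **Setting.** Let $d,n\ge 0$ be integers; let $M\in\mathbb R^{d\times d}$ and $M_z\in\mathbb R^{n\times n}$ be symmetric positive definite, $V:\mathbb R^d\to\mathbb R$ of class $C^1$, $\xi:\mathbb R^d\to\mathbb R^n$ of class $C^2$, $\beta,\nu,\delta t>0$, and assume $\int e^{-\beta V(q)}dq<\infty$. Let $\gamma,\gamma_z$ be symmetric positive semi-definite matrices and $\sigma,\sigma_z$ square matrices with $\sigma\sigma^T=\frac2\beta\gamma$, $\sigma_z\sigma_z^T=\frac2\beta\gamma_z$. Write $(\nabla\xi)_{ij}=\partial\xi_j/\partial q_i$ and $$M_\nu=M+\nu^2\nabla\xi\,M_z\nabla\xi^T,\qquad V_{\mathrm{fix},\nu}=\tfrac1{2\beta}\ln\det M_\nu,\qquad H_\nu(p_\nu,q)=\tfrac12p_\nu^TM_\nu(q)^{-1}p_\nu+V(q)+V_{\mathrm{fix},\nu}(q).$$ The penalized canonical distribution is $\mu_\nu(dp_\nu\,dq)=Z_\nu^{-1}e^{-\beta H_\nu(p_\nu,q)}dp_\nu\,dq$. States of the scheme are points $x=(q,z,p,p_z)$ of the extended space $\mathbb R^d\times\mathbb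 R^n\times\mathbb R^d\times\mathbb R^n$; the constrained phase space $\Sigma$ is the set of those with $\xi(q)=z/\nu$ and $\nabla\xi(q)^TM^{-1}p=\frac1\nu M_z^{-1}p_z$. A pair $(p_\nu,q)$ is identified with the point $(q,\ \nu\xi(q),\ Mv,\ \nu M_z\nabla\xi(q)^Tv)$, $v=M_\nu(q)^{-1}p_\nu$, of $\Sigma$, and $\mu_\nu$ is also regarded as a distribution on the extended space in this way. Let $$H_{\mathrm{IMMP}}(q,z,p,p_z)=\tfrac12p^TM^{-1}p+\tfrac12p_z^TM_z^{-1}p_z+V(q)+V_{\mathrm{fix},\nu}(q).$$ **Integrator.** A leapfrog/RATTLE step from $(q,z,p,p_z)$ to $(q',z',p',p_z')$ is a solution, with multipliers $\lambda,\lambda'\in\mathbb R^n$ and half-step momenta $\hat p,\hat p_z$, of $$\hat p=p-\tfrac{\delta t}2\nabla(V+V_{\mathrm{fix},\nu})(q)-\nabla\xi(q)\lambda,\quad \hat p_z=p_z+\tfrac1\nu\lambda,\quad q'=q+\delta t\,M^{-1}\hat p,\quad z'=z+\delta t\,M_z^{-1}\hat p_z,\quad \xi(q')=z'/\nu,$$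 $$p'=\hat p-\tfrac{\delta t}2\nabla(V+V_{\mathrm{fix},\nu})(q')-\nabla\xi(q')\lambda',\quad p_z'=\hat p_z+\tfrac1\nu\lambda',\quad \nabla\xi(q')^TM^{-1}p'=\tfrac1\nu M_z^{-1}p_z'.$$ Let $D_{\delta t}$ be a domain where the constraints are solvable: a measurable set of states, stable under the momentum flip $(q,z,p,p_z)\mapsto(q,z,-p,-p_z)$, at each of which this step has exactly one solution $(q',z',p',p_z')$. **Scheme.** Steps 1 and 2. If the current state $x$ and its leapfrog step $x'$ both lie in $D_{\delta t}$, move to $x'$ with probability $\min(1,e^{-\beta(H_{\mathrm{IMMP}}(x')-H_{\mathrm{IMMP}}(x))})$; in all other cases (rejection, or a step that cannot be performed within $D_{\delta t}$) flip the momenta of $x$. Step 3. With independent standard Gaussian vectors $U\in\mathbb R^d$, $U_z\in\mathbb R^n$, keep $(q,z)$ and replace $(p,p_z)$ by the solution $(p',p_z')$ (with a multiplier $\lambda\in\mathbb R^n$) of the mid-point Euler step $$p'=p-\tfrac{\delta t}2\gamma M^{-1}(p+p')+\sqrt{\delta t}\,\sigma U-\nabla\xi(q)\lambda,\quad p_z'=p_z-\tfrac{\delta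 t}2\gamma_zM_z^{-1}(p_z+p_z')+\sqrt{\delta t}\,\sigma_zU_z+\tfrac1\nu\lambda,\quad \nabla\xi(q)^TM^{-1}p'=\tfrac1\nu M_z^{-1}p_z'.$$ **Proposition (exact sampling).** 1. $\mu_\nu$ is a probability distribution. The equations of Step 3 always have exactly one solution $(p',p_z')$; Steps 1-2 and Step 3 define Markov kernels $Q$ and $R$ on the extended space, so that the scheme ($Q$ followed by $R$) defines a Markov chain. This chain, started in $\Sigma$, stays in $\Sigma$ almost surely. 2. The chain leaves $\mu_\nu$ invariant. 3. Conditioning to $D_{\delta t}$: Steps 1-2 leave $\mu_\nu(\,\cdot\mid D_{\delta t})$ invariant. So does the whole chain, if Step 3 started in $D_{\delta t}$ almost surely stays in $D_{\delta t}$ (for $\mu_\nu$-almost every initial state). In general, so does the chain restricted to $D_{\delta t}$, in which an update of Step 3 that would leave $D_{\delta t}$ is rejected (the state reached after Step 2 is kept); this restricted chain is a Markov chain that, started in $D_{\delta t}$, stays in $D_{\delta t}$ almost surely. (If $\mu_\nu(D_{\delta t})=0$, the conditional distribution is read as the zero measure.) 4. The position marginal of $\mu_\nu$ is the probability distribution $e^{-\beta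 V(q)}dq\big/\int e^{-\beta V(q)}dq$, which is independent of $\nu$. -/

import Mathlib

open MeasureTheory ProbabilityTheory
open scoped Matrix ENNReal

noncomputable section

/-- The data of the implicit mass-matrix penalization (IMMP) method in `ℝ^d` with `n` fast degrees
of freedom. The standing assumptions on the data are hypotheses of the theorem. -/
structure IMMPData (d n : ℕ) where
  /-- mass matrix `M` -/
  M : Matrix (Fin d) (Fin d) ℝ
  /-- virtual mass matrix `M_z` of the auxiliary variables -/
  Mz : Matrix (Fin n) (Fin n) ℝ
  /-- potential energy `V` -/
  V : (Fin d → ℝ) → ℝ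
  /-- fast degrees of freedom `ξ` -/
  ξ : (Fin d → ℝ) → (Fin n → ℝ)
  /-- inverse temperature `β` -/
  β : ℝ
  /-- penalty intensity `ν` -/
  ν : ℝ
  /-- time step `δt` -/
  δt : ℝ
  /-- dissipation matrix `γ` -/
  γ : Matrix (Fin d) (Fin d) ℝ
  /-- dissipation matrix `γ_z` of the auxiliary variables -/
  γz : Matrix (Fin n) (Fin n) ℝ
  /-- fluctuation matrix `σ` -/
  σ : Matrix (Fin d) (Fin d) ℝ
  /-- fluctuation matrix `σ_z` of the auxiliary variables -/
  σz : Matrix (Fin n) (Fin n) ℝ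

/-- The extended phase space, with points `(q, z, p, p_z)`. -/
abbrev ExtPhase (d n : ℕ) : Type :=
  (Fin d → ℝ) × (Fin n → ℝ) × (Fin d → ℝ) × (Fin n → ℝ)

namespace ExtPhase

variable {d n : ℕ}

/-- position `q` -/
abbrev q (x : ExtPhase d n) : Fin d → ℝ := x.1
/-- auxiliary position `z` -/
abbrev z (x : ExtPhase d n) : Fin n → ℝ := x.2.1
/-- impulse `p` -/
abbrev p (x : ExtPhase d n) : Fin d → ℝ := x.2.2.1
/-- auxiliary impulse `p_z` -/
abbrev pz (x : ExtPhase d n) : Fin n → ℝ := x.2.2.2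

/-- Momentum flip `(q, z, p, p_z) ↦ (q, z, -p, -p_z)`. -/
def flip (x : ExtPhase d n) : ExtPhase d n := (x.q, x.z, -x.p, -x.pz)

end ExtPhase

/-- The gradient of a real function on `ℝ^d`, in the standard basis. -/
def gradient' {d : ℕ} (f : (Fin d → ℝ) → ℝ) (q : Fin d → ℝ) : Fin d → ℝ :=
  fun i => fderiv ℝ f q (Pi.single i 1)

/-- The canonical distribution in position variables: the probability measure on `ℝ^d` with density
proportional to `exp (-β V(q))`. -/
def positionCanonical {d : ℕ} (β : ℝ) (V : (Fin d → ℝ) → ℝ) : Measure (Fin d → ℝ) :=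
  (∫⁻ q, ENNReal.ofReal (Real.exp (-β * V q)))⁻¹ •
    (volume : Measure (Fin d → ℝ)).withDensity (fun q => ENNReal.ofReal (Real.exp (-β * V q)))

namespace IMMPData

variable {d n : ℕ} (S : IMMPData d n)

/-- The `d × n` matrix `∇_q ξ`, with entries `(∇_q ξ)_{ij} = ∂ξ_j/∂q_i`. -/
def gradXi (q : Fin d → ℝ) : Matrix (Fin d) (Fin n) ℝ :=
  Matrix.of fun i j => fderiv ℝ S.ξ q (Pi.single i 1) j

/-- The penalized mass matrix `M_ν(q) = M + ν² ∇ξ M_z ∇ξᵀ`. -/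
def penMass (q : Fin d → ℝ) : Matrix (Fin d) (Fin d) ℝ :=
  S.M + S.ν ^ 2 • (S.gradXi q * S.Mz * (S.gradXi q)ᵀ)

/-- The corrected Fixman potential `V_{fix,ν}(q) = (1/(2β)) ln det M_ν(q)`. -/
def fixman (q : Fin d → ℝ) : ℝ :=
  1 / (2 * S.β) * Real.log (S.penMass q).det

/-- The gradient of the total potential, `∇V + ∇V_{fix,ν}`. -/
def gradPot (q : Fin d → ℝ) : Fin d → ℝ :=
  gradient' S.V q + gradient' S.fixman q

/-- The mass-penalized Hamiltonian `H_ν(p_ν, q)`. -/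
def penHamiltonian (pν q : Fin d → ℝ) : ℝ :=
  1 / 2 * (pν ⬝ᵥ (S.penMass q)⁻¹ *ᵥ pν) + S.V q + S.fixman q

/-- The extended Hamiltonian `H_IMMP` of a state `(q, z, p, p_z)`. -/
def hamiltonian (x : ExtPhase d n) : ℝ :=
  1 / 2 * (x.p ⬝ᵥ S.M⁻¹ *ᵥ x.p) + 1 / 2 * (x.pz ⬝ᵥ S.Mz⁻¹ *ᵥ x.pz) + S.V x.q + S.fixman x.q

/-- The position constraints `ξ(q) = z/ν`. -/
def PosConstraint (x : ExtPhase d n) : Prop :=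
  S.ξ x.q = (1 / S.ν) • x.z

/-- The hidden constraints on impulses `∇ξ(q)ᵀ M⁻¹ p = (1/ν) M_z⁻¹ p_z`. -/
def MomConstraint (x : ExtPhase d n) : Prop :=
  (S.gradXi x.q)ᵀ *ᵥ (S.M⁻¹ *ᵥ x.p) = (1 / S.ν) • (S.Mz⁻¹ *ᵥ x.pz)

/-- The constrained phase space of the IMMP method, inside the extended phase space. -/
def constrainedPhase : Set (ExtPhase d n) :=
  {x | S.PosConstraint x ∧ S.MomConstraint x}

/-- The penalized canonical distribution `Z_ν⁻¹ exp (-β H_ν(p_ν, q)) dp_ν dq`, as a measure on the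
pairs `(p_ν, q)`. -/
def penCanonical : Measure ((Fin d → ℝ) × (Fin d → ℝ)) :=
  (∫⁻ y : (Fin d → ℝ) × (Fin d → ℝ),
      ENNReal.ofReal (Real.exp (-S.β * S.penHamiltonian y.1 y.2)))⁻¹ •
    (volume : Measure ((Fin d → ℝ) × (Fin d → ℝ))).withDensity
      (fun y => ENNReal.ofReal (Real.exp (-S.β * S.penHamiltonian y.1 y.2)))

/-- The identification of the pairs `(p_ν, q)` with the constrained phase space: with the velocity
`v = M_ν(q)⁻¹ p_ν`, it is given by `z = ν ξ(q)`, `p = M v` (that is, `p_ν = M_ν(q) M⁻¹ p`) and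
`p_z = M_z ż = ν M_z ∇ξ(q)ᵀ v`. -/
def embed (y : (Fin d → ℝ) × (Fin d → ℝ)) : ExtPhase d n :=
  (y.2, S.ν • S.ξ y.2, S.M *ᵥ ((S.penMass y.2)⁻¹ *ᵥ y.1),
    S.ν • (S.Mz *ᵥ ((S.gradXi y.2)ᵀ *ᵥ ((S.penMass y.2)⁻¹ *ᵥ y.1))))

/-- The penalized canonical distribution in the variables `(q, z, p, p_z)` of the scheme. -/
def extCanonical : Measure (ExtPhase d n) := S.penCanonical.map S.embed

/-- One step `x = (q_n, z_n, p_n, p^z_n) ↦ y = (q_{n+1}, z_{n+1}, p_{n+1}, p^z_{n+1})` of the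
leapfrog/Verlet (RATTLE) integrator with constraints; `pH`, `pzH` are the impulses at the half step
and `lH`, `l` the Lagrange multipliers `λ_{n+1/2}`, `λ_{n+1}`. -/
def IsLeapfrogStep (x y : ExtPhase d n) : Prop :=
  ∃ (pH : Fin d → ℝ) (pzH lH l : Fin n → ℝ),
    pH = x.p - (S.δt / 2) • S.gradPot x.q - S.gradXi x.q *ᵥ lH ∧
    pzH = x.pz + (1 / S.ν) • lH ∧
    y.q = x.q + S.δt • (S.M⁻¹ *ᵥ pH) ∧
    y.z = x.z + S.δt • (S.Mz⁻¹ *ᵥ pzH) ∧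
    S.PosConstraint y ∧
    y.p = pH - (S.δt / 2) • S.gradPot y.q - S.gradXi y.q *ᵥ l ∧
    y.pz = pzH + (1 / S.ν) • l ∧
    S.MomConstraint y

/-- A solution of the integrator (used only at states where there is exactly one). -/
def leapfrog (x : ExtPhase d n) : ExtPhase d n :=
  Classical.epsilon (S.IsLeapfrogStep x)

/-- A domain `D_δt` of the extended phase space where the integrator with constraints has a unique
solution: a measurable set, stable under the momentum flip (which the scheme applies upon
rejection), at each state of which the integrator has exactly one solution. -/
structure IsSolvabilityDomain (D : Set (ExtPhase d n)) : Prop where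
  measurableSet : MeasurableSet D
  flip_mem : ∀ x ∈ D, x.flip ∈ D
  existsUnique : ∀ x ∈ D, ∃! y, S.IsLeapfrogStep x y

/-- The Metropolis acceptance probability `min (1, exp (-β ΔH))` of a move from `x` to `y`. -/
def acceptProb (x y : ExtPhase d n) : ℝ :=
  min 1 (Real.exp (-S.β * (S.hamiltonian y - S.hamiltonian x)))

open Classical in
/-- Steps 1 and 2 of the scheme, as a transition probability: the leapfrog step is accepted with the
Metropolis probability if it can be performed and ends in `D`; otherwise the state is kept and its
momenta are flipped. A step that cannot be performed within `D` counts as rejected (`ΔH = +∞`). -/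
def metropolisLaw (D : Set (ExtPhase d n)) (x : ExtPhase d n) : Measure (ExtPhase d n) :=
  if x ∈ D ∧ S.leapfrog x ∈ D then
    ENNReal.ofReal (S.acceptProb x (S.leapfrog x)) • Measure.dirac (S.leapfrog x) +
      ENNReal.ofReal (1 - S.acceptProb x (S.leapfrog x)) • Measure.dirac x.flip
  else Measure.dirac x.flip

/-- One step of the mid-point Euler scheme with constraints for the fluctuation/dissipation part,
from `x` to `y`, with the noise `u`; `l` is the Lagrange multiplier. -/
def IsMidpointStep (x : ExtPhase d n) (u : (Fin d → ℝ) × (Fin n → ℝ)) (y : ExtPhase d n) : Prop :=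
  ∃ l : Fin n → ℝ,
    y.q = x.q ∧ y.z = x.z ∧
    y.p = x.p - (S.δt / 2) • (S.γ *ᵥ (S.M⁻¹ *ᵥ (x.p + y.p)))
      + Real.sqrt S.δt • (S.σ *ᵥ u.1) - S.gradXi x.q *ᵥ l ∧
    y.pz = x.pz - (S.δt / 2) • (S.γz *ᵥ (S.Mz⁻¹ *ᵥ (x.pz + y.pz)))
      + Real.sqrt S.δt • (S.σz *ᵥ u.2) + (1 / S.ν) • l ∧
    S.MomConstraint y

/-- The solution of the mid-point Euler scheme (it always has exactly one). -/
def midpointStep (x : ExtPhase d n) (u : (Fin d → ℝ) × (Fin n → ℝ)) : ExtPhase d n :=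
  Classical.epsilon (S.IsMidpointStep x u)

/-- Step 3 of the scheme, as a transition probability: the law of the mid-point Euler step driven by
a standard Gaussian vector. -/
def thermostatLaw (x : ExtPhase d n) : Measure (ExtPhase d n) :=
  ((Measure.pi fun _ : Fin d => gaussianReal 0 1).prod
    (Measure.pi fun _ : Fin n => gaussianReal 0 1)).map (S.midpointStep x)

/-- Step 3 restricted to `D`: an update that would leave `D` is rejected. -/
def restrictedThermostatLaw (D : Set (ExtPhase d n)) (x : ExtPhase d n) :
    Measure (ExtPhase d n) :=
  (S.thermostatLaw x).restrict D + S.thermostatLaw x Dᶜ • Measure.dirac x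

end IMMPData

end

/-! Everything is reduced to the pairs `(p_ν, q)`. On the constrained phase space `p = M v` and `p_z
= ν M_z ∇ξᵀ v` for one velocity `v`, and `p_ν = p + ν ∇ξ p_z = M_ν v` is a global coordinate above
`q`. A multiplier enters as `-∇ξ λ` in `p` and `λ/ν` in `p_z`, so it cancels in `p + ν ∇ξ p_z` if
`∇ξ` is taken at the same point: both constrained steps become unconstrained in `(p_ν, q)`, and
`H_IMMP` becomes `H_ν`.

Position marginal. Given `q`, `p_ν` is centred Gaussian with covariance `β⁻¹ M_ν(q)`. The
normalization is proportional to `√det M_ν`, which the Fixman factor `exp (-β V_fix) = (det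
M_ν)^(-1/2)` removes (`lintegral_penWeight_fiber`).

Step 3. Here `q` is frozen and `p_ν` moves by `A p_ν + B U + B_z U_z` with `A = 2 M_ν N⁻¹ - 1`,
where `N = M_ν + (δt/2)(γ + ν² ∇ξ γ_z ∇ξᵀ)`. With `K = β⁻¹ M_ν`, `A K` is symmetric, and
fluctuation-dissipation gives `A K Aᵀ + B Bᵀ + B_z B_zᵀ = K` (`midpoint_covariance`). Current and
next impulses are then an exchangeable Gaussian pair (`map_gaussian_pair_swap`), so the step is
reversible on each fibre.

Steps 1 and 2. A leapfrog step is parametrized by its endpoints: it goes from `(α(q,q'), q)` to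
`(-α(q',q), q')` with `α = discImpulse` (`isLeapfrogStep_embed_iff`). After a flip, it exchanges
`(α(q,q'), q)` and `(α(q',q), q')`. The Jacobian matrices of `α(q,·)` at `q'` and of `α(q',·)` at
`q` are transposes of each other, so the exchange preserves Lebesgue measure
(`setLIntegral_eq_of_symmetric_generating`). This needs only unique solvability on `D`, not
regularity of the leapfrog map. The Metropolis rule then gives detailed balance up to a flip, hence
invariance, since the measure is even in the impulses.

Conditioning. Moves of Steps 1 and 2 take place inside the flip-stable set `D`, so the same balance
holds for the restriction to `D`; for Step 3, rejecting exits preserves the restriction of a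
reversible measure. -/

/-! ### Gaussian measures and exchangeable Gaussian pairs. -/

section Gaussian

/-- The standard Gaussian measure on `ι → ℝ`. -/
noncomputable abbrev stdPi (ι : Type*) [Fintype ι] : Measure (ι → ℝ) :=
  Measure.pi fun _ : ι => gaussianReal 0 1

theorem stdPi_eq_withDensity (ι : Type*) [Fintype ι] :
    stdPi ι = (volume : Measure (ι → ℝ)).withDensity
      (fun x => ENNReal.ofReal ((√(2 * Real.pi))⁻¹ ^ Fintype.card ι * Real.exp (-(1 / 2) * (x ⬝ᵥ x)))) := by
  classical
  have hd : ∀ x : ι → ℝ, ENNReal.ofReal ((√(2 * Real.pi))⁻¹ ^ Fintype.card ι *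
      Real.exp (-(1 / 2) * (x ⬝ᵥ x))) = ∏ i, gaussianPDF 0 1 (x i) := by
    intro x
    simp only [gaussianPDF]
    rw [← ENNReal.ofReal_prod_of_nonneg (fun i _ => gaussianPDFReal_nonneg _ _ _)]
    congr 1
    simp only [gaussianPDFReal_def, Finset.prod_mul_distrib, Finset.prod_const, Finset.card_univ,
      ← Real.exp_sum]
    congr 2
    · simp
    · rw [dotProduct, Finset.mul_sum]
      refine Finset.sum_congr rfl fun i _ => ?_
      simp; ring
  refine (Measure.pi_eq fun s hs => ?_)
  rw [withDensity_apply _ (MeasurableSet.univ_pi hs)]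
  have hd' : ∀ x : ι → ℝ, ENNReal.ofReal ((√(2 * Real.pi))⁻¹ ^ Fintype.card ι *
      Real.exp (-(1 / 2) * (x ⬝ᵥ x))) = ENNReal.ofReal (∏ i, gaussianPDFReal 0 1 (x i)) := by
    intro x
    rw [hd x, ENNReal.ofReal_prod_of_nonneg (fun i _ => gaussianPDFReal_nonneg _ _ _)]
    rfl
  simp only [hd']
  rw [volume_pi, Measure.restrict_pi_pi, ← ofReal_integral_eq_lintegral_ofReal]
  · rw [integral_fintype_prod_eq_prod, ENNReal.ofReal_prod_of_nonneg]
    · simp only [gaussianReal_apply_eq_integral 0 one_ne_zero]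
    · exact fun i _ => integral_nonneg fun x => gaussianPDFReal_nonneg _ _ _
  · exact Integrable.fintype_prod fun i => (integrable_gaussianPDFReal 0 1).restrict
  · exact .of_forall fun x => Finset.prod_nonneg fun i _ => gaussianPDFReal_nonneg _ _ _

theorem charFunDual_stdPi {ι : Type*} [Fintype ι] (ℓ : StrongDual ℝ (ι → ℝ)) (a : ι → ℝ)
    (h : ∀ x, ℓ x = a ⬝ᵥ x) :
    charFunDual (stdPi ι) ℓ = Complex.exp (-((a ⬝ᵥ a : ℝ) : ℂ) / 2) := by
  classical
  have hi : ∀ M : StrongDual ℝ ℝ, charFunDual (gaussianReal 0 1) M =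
      Complex.exp (-((M 1 * M 1 : ℝ) : ℂ) / 2) := by
    intro M
    rw [IsGaussian.charFunDual_eq, integral_complex_ofReal,
      integral_continuousLinearMap_gaussianReal, variance_continuousLinearMap_gaussianReal]
    simp [pow_two, neg_div, mul_self_nonneg]
  rw [charFunDual_pi]
  have h1 : ∀ i, (ℓ.comp (ContinuousLinearMap.single ℝ (fun _ : ι => ℝ) i)) 1 = a i := by
    intro i
    simp [h]
  simp only [hi, h1, ← Complex.exp_sum, dotProduct, Complex.ofReal_sum, neg_div, Finset.sum_div,
    Finset.sum_neg_distrib]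

theorem exists_dotProduct_eq {ι : Type*} [Fintype ι] (ℓ : (ι → ℝ) →ₗ[ℝ] ℝ) :
    ∃ a : ι → ℝ, ∀ x, ℓ x = a ⬝ᵥ x := by
  classical
  refine ⟨fun i => ℓ (Pi.single i 1), fun x => ?_⟩
  have hx : x = ∑ i, x i • (Pi.single i 1 : ι → ℝ) := by
    ext j
    simp [Finset.sum_apply, Pi.single_apply]
  conv_lhs => rw [hx]
  simp only [map_sum, map_smul, dotProduct, smul_eq_mul, mul_comm]

theorem vecMul_dotProduct_vecMul {ι κ : Type*} [Fintype ι] [Fintype κ] (s t : ι → ℝ)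
    (M N : Matrix ι κ ℝ) : (s ᵥ* M) ⬝ᵥ (t ᵥ* N) = s ⬝ᵥ (M * Nᵀ) *ᵥ t := by
  rw [← Matrix.mulVec_transpose N, Matrix.dotProduct_mulVec, Matrix.vecMul_vecMul,
    ← Matrix.dotProduct_mulVec]

theorem charFunDual_stdPi_prod {κ₀ κ₁ κ₂ : Type*} [Fintype κ₀] [Fintype κ₁] [Fintype κ₂]
    (ℓ : StrongDual ℝ ((κ₀ → ℝ) × (κ₁ → ℝ) × (κ₂ → ℝ))) (a : κ₀ → ℝ) (b : κ₁ → ℝ) (c : κ₂ → ℝ)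
    (h : ∀ w, ℓ w = a ⬝ᵥ w.1 + (b ⬝ᵥ w.2.1 + c ⬝ᵥ w.2.2)) :
    charFunDual ((stdPi κ₀).prod ((stdPi κ₁).prod (stdPi κ₂))) ℓ =
      Complex.exp (-((a ⬝ᵥ a + (b ⬝ᵥ b + c ⬝ᵥ c) : ℝ) : ℂ) / 2) := by
  rw [charFunDual_prod, charFunDual_prod, charFunDual_stdPi _ a, charFunDual_stdPi _ b,
    charFunDual_stdPi _ c, ← Complex.exp_add, ← Complex.exp_add]
  · congr 1
    push_cast
    ring
  all_goals
    intro x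
    simp [h]

/-- If `A K` is symmetric and `A K Aᵀ + B Bᵀ = K`, the pair `(X, A X + B U)` with `X` of law
`N(0, K)` and `U` standard Gaussian is exchangeable. -/
theorem map_gaussian_pair_swap {ι κ₁ κ₂ : Type*} [Fintype ι] [Fintype κ₁] [Fintype κ₂]
    (K L A : Matrix ι ι ℝ) (B₁ : Matrix ι κ₁ ℝ) (B₂ : Matrix ι κ₂ ℝ)
    (hK : L * Lᵀ = K) (hAK : A * K = K * Aᵀ) (hcov : A * K * Aᵀ + (B₁ * B₁ᵀ + B₂ * B₂ᵀ) = K) :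
    ((stdPi ι).prod ((stdPi κ₁).prod (stdPi κ₂))).map
        (fun w => (L *ᵥ w.1, A *ᵥ (L *ᵥ w.1) + (B₁ *ᵥ w.2.1 + B₂ *ᵥ w.2.2))) =
      ((stdPi ι).prod ((stdPi κ₁).prod (stdPi κ₂))).map
        (fun w => (A *ᵥ (L *ᵥ w.1) + (B₁ *ᵥ w.2.1 + B₂ *ᵥ w.2.2), L *ᵥ w.1)) := by
  classical
  obtain ⟨T₁, hT₁⟩ : ∃ T : (ι → ℝ) × (κ₁ → ℝ) × (κ₂ → ℝ) →L[ℝ] (ι → ℝ),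
      ∀ w, T w = L *ᵥ w.1 :=
    ⟨(LinearMap.toContinuousLinearMap L.mulVecLin).comp (.fst ℝ _ _), fun w => rfl⟩
  obtain ⟨T₂, hT₂⟩ : ∃ T : (ι → ℝ) × (κ₁ → ℝ) × (κ₂ → ℝ) →L[ℝ] (ι → ℝ),
      ∀ w, T w = A *ᵥ (L *ᵥ w.1) + (B₁ *ᵥ w.2.1 + B₂ *ᵥ w.2.2) :=
    ⟨(LinearMap.toContinuousLinearMap A.mulVecLin).comp T₁ +
      ((LinearMap.toContinuousLinearMap B₁.mulVecLin).comp
          ((ContinuousLinearMap.fst ℝ _ _).comp (.snd ℝ _ _)) +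
        (LinearMap.toContinuousLinearMap B₂.mulVecLin).comp
          ((ContinuousLinearMap.snd ℝ _ _).comp (.snd ℝ _ _))), fun w => by simp [hT₁]⟩
  simp only [← hT₂]
  simp only [← hT₁]
  change Measure.map (T₁.prod T₂) _ = Measure.map (T₂.prod T₁) _
  -- The left side is the variance of `s·X + t·Y`, with `X = L u` and `Y = A X + B₁ U₁ + B₂ U₂`;
  -- `hcov` says that `Y` has the covariance `K` of `X`.
  have key : ∀ s t : ι → ℝ,
      (s ᵥ* L + t ᵥ* (A * L)) ⬝ᵥ (s ᵥ* L + t ᵥ* (A * L)) +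
        ((t ᵥ* B₁) ⬝ᵥ (t ᵥ* B₁) + (t ᵥ* B₂) ⬝ᵥ (t ᵥ* B₂)) =
      s ⬝ᵥ K *ᵥ s + 2 * (s ⬝ᵥ (K * Aᵀ) *ᵥ t) + t ⬝ᵥ K *ᵥ t := by
    have hsymm : Kᵀ = K := by rw [← hK]; simp
    intro s t
    have hst : t ⬝ᵥ (A * K) *ᵥ s = s ⬝ᵥ (K * Aᵀ) *ᵥ t := by
      rw [Matrix.dotProduct_mulVec, dotProduct_comm, ← Matrix.mulVec_transpose,
        Matrix.transpose_mul, hsymm]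
    have h1 : L * (A * L)ᵀ = K * Aᵀ := by rw [Matrix.transpose_mul, ← Matrix.mul_assoc, hK]
    have h2 : A * L * Lᵀ = A * K := by rw [Matrix.mul_assoc, hK]
    have h3 : A * L * (A * L)ᵀ = A * K * Aᵀ := by
      rw [Matrix.mul_assoc, h1, ← Matrix.mul_assoc]
    rw [add_dotProduct, dotProduct_add, dotProduct_add]
    simp only [vecMul_dotProduct_vecMul, h1, h2, h3, hK, hst]
    have h4 := congrArg (fun M => t ⬝ᵥ M *ᵥ t) hcov
    simp only [Matrix.add_mulVec, dotProduct_add] at h4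
    linarith
  -- The cross-covariance is symmetric, so exchanging `s` and `t` does not change the variance,
  -- hence not the characteristic function.
  have hsw : ∀ s t : ι → ℝ, s ⬝ᵥ (K * Aᵀ) *ᵥ t = t ⬝ᵥ (K * Aᵀ) *ᵥ s := by
    have hsymm : Kᵀ = K := by rw [← hK]; simp
    intro s t
    rw [← hAK, Matrix.dotProduct_mulVec, dotProduct_comm, ← Matrix.mulVec_transpose,
      Matrix.transpose_mul, hsymm, hAK]
  refine Measure.ext_of_charFunDual (funext fun ℓ => ?_)
  obtain ⟨s, hs⟩ := exists_dotProduct_eq (ℓ.toLinearMap ∘ₗ LinearMap.inl ℝ _ _)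
  obtain ⟨t, ht⟩ := exists_dotProduct_eq (ℓ.toLinearMap ∘ₗ LinearMap.inr ℝ _ _)
  have hℓ : ∀ x y, ℓ (x, y) = s ⬝ᵥ x + t ⬝ᵥ y := by
    intro x y
    rw [← hs, ← ht, LinearMap.comp_apply, LinearMap.comp_apply, ← map_add]
    simp
  rw [charFunDual_map, charFunDual_map,
    charFunDual_stdPi_prod _ (s ᵥ* L + t ᵥ* (A * L)) (t ᵥ* B₁) (t ᵥ* B₂),
    charFunDual_stdPi_prod _ (t ᵥ* L + s ᵥ* (A * L)) (s ᵥ* B₁) (s ᵥ* B₂), key, key, hsw t s]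
  · congr 4
    ring
  all_goals
    intro w
    rw [ContinuousLinearMap.comp_apply, ContinuousLinearMap.prod_apply, hℓ, hT₁, hT₂]
    simp only [dotProduct_add, add_dotProduct, Matrix.dotProduct_mulVec, Matrix.vecMul_vecMul]
    ring

open scoped MatrixOrder in
theorem Matrix.PosDef.exists_mul_transpose_eq {ι : Type*} [Fintype ι] [DecidableEq ι]
    {K : Matrix ι ι ℝ} (hK : K.PosDef) : ∃ L : Matrix ι ι ℝ, L * Lᵀ = K := by
  refine ⟨CFC.sqrt K, ?_⟩
  have h : (CFC.sqrt K).IsHermitian := (Matrix.nonneg_iff_posSemidef.1 (CFC.sqrt_nonneg K)).1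
  rw [← Matrix.conjTranspose_eq_transpose_of_trivial, h.eq]
  exact CFC.sqrt_mul_sqrt_self K (Matrix.nonneg_iff_posSemidef.2 hK.posSemidef)

/-- A Gaussian integral with covariance `L Lᵀ` as an integral against the standard Gaussian. -/
theorem lintegral_exp_neg_half_mul {ι : Type*} [Fintype ι] [DecidableEq ι] {K L : Matrix ι ι ℝ}
    (hK : K.PosDef) (hL : L * Lᵀ = K) (f : (ι → ℝ) → ℝ≥0∞) (hf : Measurable f) :
    ∫⁻ p : ι → ℝ, ENNReal.ofReal (Real.exp (-(1 / 2) * (p ⬝ᵥ K⁻¹ *ᵥ p))) * f p =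
      ENNReal.ofReal (√(2 * Real.pi) ^ Fintype.card ι * √K.det) *
        ∫⁻ u, f (L *ᵥ u) ∂(stdPi ι) := by
  have hdet : L.det * L.det = K.det := by
    rw [← hL, Matrix.det_mul, Matrix.det_transpose]
  have hL0 : L.det ≠ 0 := fun h => by
    have := hK.det_pos
    rw [← hdet, h] at this
    simp at this
  have hLu : IsUnit L.det := isUnit_iff_ne_zero.2 hL0
  have habs : |L.det| = √K.det := by
    rw [← hdet, Real.sqrt_mul_self_eq_abs]
  have hc : (0 : ℝ) < √(2 * Real.pi) := Real.sqrt_pos.2 (by positivity)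
  -- The substitution `p = L u` whitens the quadratic form; its Jacobian `|det L| = √det K` is the
  -- constant of the statement.
  have hq : ∀ u : ι → ℝ, (L *ᵥ u) ⬝ᵥ K⁻¹ *ᵥ (L *ᵥ u) = u ⬝ᵥ u := by
    intro u
    have : K⁻¹ *ᵥ (L *ᵥ u) = (Lᵀ)⁻¹ *ᵥ u := by
      rw [← hL, Matrix.mul_inv_rev, Matrix.mulVec_mulVec, Matrix.mul_assoc,
        Matrix.nonsing_inv_mul _ hLu, Matrix.mul_one]
    rw [this, ← Matrix.vecMul_transpose, ← Matrix.dotProduct_mulVec, Matrix.mulVec_mulVec,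
      Matrix.mul_nonsing_inv _ (by rwa [Matrix.det_transpose]), Matrix.one_mulVec]
  have hmeas : Measurable fun u : ι → ℝ => L *ᵥ u :=
    (Continuous.matrix_mulVec continuous_const continuous_id).measurable
  have hg : Measurable fun p : ι → ℝ =>
      ENNReal.ofReal (Real.exp (-(1 / 2) * (p ⬝ᵥ K⁻¹ *ᵥ p))) * f p := by
    refine Measurable.mul ?_ hf
    have : Continuous fun p : ι → ℝ => p ⬝ᵥ K⁻¹ *ᵥ p :=
      continuous_id.dotProduct (Continuous.matrix_mulVec continuous_const continuous_id)
    exact (Real.continuous_exp.comp (continuous_const.mul this)).measurable.ennreal_ofReal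
  have hmap : (volume : Measure (ι → ℝ)) =
      ENNReal.ofReal |L.det| • Measure.map (fun u : ι → ℝ => L *ᵥ u) volume := by
    have h := Real.map_matrix_volume_pi_eq_smul_volume_pi hL0
    change Measure.map (fun u : ι → ℝ => L *ᵥ u) volume = _ at h
    rw [h, smul_smul, ← ENNReal.ofReal_mul (abs_nonneg _), abs_inv,
      mul_inv_cancel₀ (abs_ne_zero.2 hL0), ENNReal.ofReal_one, one_smul]
  conv_lhs => rw [hmap]
  have hfm : Measurable fun u => f (L *ᵥ u) := hf.comp hmeas
  have hde : Measurable fun x : ι → ℝ => ENNReal.ofReal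
      ((√(2 * Real.pi))⁻¹ ^ Fintype.card ι * Real.exp (-(1 / 2) * (x ⬝ᵥ x))) := by
    have : Continuous fun x : ι → ℝ => x ⬝ᵥ x := continuous_id.dotProduct continuous_id
    exact (continuous_const.mul
      (Real.continuous_exp.comp (continuous_const.mul this))).measurable.ennreal_ofReal
  rw [lintegral_smul_measure, lintegral_map hg hmeas, stdPi_eq_withDensity,
    lintegral_withDensity_eq_lintegral_mul _ hde hfm, smul_eq_mul,
    ← lintegral_const_mul _ (hde.mul hfm), habs]
  have hgm := hg.comp hmeas
  simp only [Function.comp_def] at hgm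
  rw [← lintegral_const_mul _ hgm]
  refine lintegral_congr fun u => ?_
  simp only [Pi.mul_apply, hq]
  rw [← mul_assoc, ← mul_assoc, ← ENNReal.ofReal_mul (Real.sqrt_nonneg _),
    ← ENNReal.ofReal_mul (by positivity)]
  congr 2
  rw [inv_pow]
  field_simp

end Gaussian

/-! ### Regularity and positivity of the penalized mass. -/

/-- The standing assumptions on the data. -/
structure IMMPData.IsAdmissible {d n : ℕ} (S : IMMPData d n) : Prop where
  posDef_M : S.M.PosDef
  posDef_Mz : S.Mz.PosDef
  contDiff_V : ContDiff ℝ 1 S.V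
  contDiff_ξ : ContDiff ℝ 2 S.ξ
  β_pos : 0 < S.β
  ν_pos : 0 < S.ν
  δt_pos : 0 < S.δt
  posSemidef_γ : S.γ.PosSemidef
  posSemidef_γz : S.γz.PosSemidef
  σ_mul : S.σ * S.σᵀ = (2 / S.β) • S.γ
  σz_mul : S.σz * S.σzᵀ = (2 / S.β) • S.γz

namespace IMMPData

variable {d n : ℕ} {S : IMMPData d n}

theorem IsAdmissible.continuous_gradXi (h : S.IsAdmissible) : Continuous S.gradXi := by
  refine continuous_matrix fun i j => ?_
  have h1 : Continuous fun q => fderiv ℝ S.ξ q (Pi.single i 1) :=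
    (h.contDiff_ξ.continuous_fderiv (by norm_num)).clm_apply continuous_const
  exact (continuous_apply j).comp h1

theorem IsAdmissible.differentiable_ξ (h : S.IsAdmissible) : Differentiable ℝ S.ξ :=
  h.contDiff_ξ.differentiable (by norm_num)

theorem IsAdmissible.posDef_penMass (h : S.IsAdmissible) (q : Fin d → ℝ) :
    (S.penMass q).PosDef := by
  refine h.posDef_M.add_posSemidef (Matrix.PosSemidef.smul ?_ (sq_nonneg _))
  simpa using h.posDef_Mz.posSemidef.mul_mul_conjTranspose_same (S.gradXi q)

theorem IsAdmissible.isUnit_det_penMass (h : S.IsAdmissible) (q : Fin d → ℝ) :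
    IsUnit (S.penMass q).det :=
  isUnit_iff_ne_zero.2 (h.posDef_penMass q).det_pos.ne'

theorem IsAdmissible.isUnit_det_M (h : S.IsAdmissible) : IsUnit S.M.det :=
  isUnit_iff_ne_zero.2 h.posDef_M.det_pos.ne'

theorem IsAdmissible.isUnit_det_Mz (h : S.IsAdmissible) : IsUnit S.Mz.det :=
  isUnit_iff_ne_zero.2 h.posDef_Mz.det_pos.ne'

theorem IsAdmissible.continuous_penMass (h : S.IsAdmissible) : Continuous S.penMass := by
  have := h.continuous_gradXi
  exact continuous_const.add (continuous_const.fun_smul ((this.matrix_mul continuous_const).matrix_mul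
    this.matrix_transpose))

theorem IsAdmissible.continuous_penMass_inv (h : S.IsAdmissible) :
    Continuous fun q => (S.penMass q)⁻¹ := by
  refine continuous_iff_continuousAt.2 fun q => ?_
  refine ContinuousAt.comp (f := S.penMass) (g := Inv.inv) ?_ h.continuous_penMass.continuousAt
  refine continuousAt_matrix_inv _ ?_
  rw [Ring.inverse_eq_inv']
  exact continuousAt_inv₀ (h.posDef_penMass q).det_pos.ne'

theorem IsAdmissible.continuous_fixman (h : S.IsAdmissible) : Continuous S.fixman :=
  (continuous_const (y := 1 / (2 * S.β))).mul (h.continuous_penMass.matrix_det.log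
    fun q => (h.posDef_penMass q).det_pos.ne')

theorem IsAdmissible.continuous_embed (h : S.IsAdmissible) : Continuous S.embed := by
  have h1 : Continuous fun y : (Fin d → ℝ) × (Fin d → ℝ) => (S.penMass y.2)⁻¹ *ᵥ y.1 :=
    (h.continuous_penMass_inv.comp continuous_snd).matrix_mulVec continuous_fst
  refine continuous_snd.prodMk (Continuous.prodMk ?_ (Continuous.prodMk ?_ ?_))
  · exact continuous_const.fun_smul (h.contDiff_ξ.continuous.comp continuous_snd)
  · exact continuous_const.matrix_mulVec h1
  · exact continuous_const.fun_smul (continuous_const.matrix_mulVec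
      ((h.continuous_gradXi.comp continuous_snd).matrix_transpose.matrix_mulVec h1))

theorem IsAdmissible.continuous_penHamiltonian (h : S.IsAdmissible) :
    Continuous fun y : (Fin d → ℝ) × (Fin d → ℝ) => S.penHamiltonian y.1 y.2 := by
  have h1 : Continuous fun y : (Fin d → ℝ) × (Fin d → ℝ) => (S.penMass y.2)⁻¹ *ᵥ y.1 :=
    (h.continuous_penMass_inv.comp continuous_snd).matrix_mulVec continuous_fst
  exact ((continuous_const.mul (continuous_fst.dotProduct h1)).add
    (h.contDiff_V.continuous.comp continuous_snd)).add (h.continuous_fixman.comp continuous_snd)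

theorem IsAdmissible.continuous_hamiltonian (h : S.IsAdmissible) :
    Continuous S.hamiltonian := by
  have hp : Continuous fun x : ExtPhase d n => x.p := by fun_prop
  have hz : Continuous fun x : ExtPhase d n => x.pz := by fun_prop
  have h1 : Continuous fun x : ExtPhase d n => 1 / 2 * (x.p ⬝ᵥ S.M⁻¹ *ᵥ x.p) :=
    continuous_const.mul (hp.dotProduct (continuous_const.matrix_mulVec hp))
  have h2 : Continuous fun x : ExtPhase d n => 1 / 2 * (x.pz ⬝ᵥ S.Mz⁻¹ *ᵥ x.pz) :=
    continuous_const.mul (hz.dotProduct (continuous_const.matrix_mulVec hz))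
  exact ((h1.add h2).add (h.contDiff_V.continuous.comp continuous_fst)).add
    (h.continuous_fixman.comp continuous_fst)

/-! ### Disintegration of the canonical distribution over positions. -/

/-- The Gibbs weight `exp (-β H_ν)` on the pairs `(p_ν, q)`. -/
noncomputable def penWeight (S : IMMPData d n) (y : (Fin d → ℝ) × (Fin d → ℝ)) : ℝ≥0∞ :=
  ENNReal.ofReal (Real.exp (-S.β * S.penHamiltonian y.1 y.2))

theorem IsAdmissible.measurable_penWeight (h : S.IsAdmissible) : Measurable S.penWeight :=
  (Real.continuous_exp.comp
    (continuous_const.mul h.continuous_penHamiltonian)).measurable.ennreal_ofReal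

/-- The Gaussian normalization `(2π/β)^{d/2}`. -/
noncomputable def gaussConst (S : IMMPData d n) : ℝ≥0∞ :=
  ENNReal.ofReal (√(2 * Real.pi) ^ d * √((S.β⁻¹) ^ d))

theorem IsAdmissible.gaussConst_ne_zero (h : S.IsAdmissible) : S.gaussConst ≠ 0 := by
  have := h.β_pos
  have := Real.pi_pos
  rw [gaussConst, ENNReal.ofReal_ne_zero_iff]
  positivity

/-- A symmetric square root of the covariance `β⁻¹ M_ν(q)` of the impulses. -/
theorem IsAdmissible.exists_sqrt_cov (h : S.IsAdmissible) (q : Fin d → ℝ) :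
    ∃ L : Matrix (Fin d) (Fin d) ℝ, L * Lᵀ = S.β⁻¹ • S.penMass q :=
  ((h.posDef_penMass q).smul (inv_pos.2 h.β_pos)).exists_mul_transpose_eq

/-- The Gaussian normalization `√det (β⁻¹ M_ν)` meets the Fixman factor `(det M_ν)^(-1/2)`, and only
a power of `β` survives. This cancellation makes the position marginal independent of `ν`. Any
square root `L` of the covariance may be used. -/
theorem IsAdmissible.lintegral_penWeight_fiber (h : S.IsAdmissible) (q : Fin d → ℝ)
    {L : Matrix (Fin d) (Fin d) ℝ} (hL : L * Lᵀ = S.β⁻¹ • S.penMass q)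
    {f : (Fin d → ℝ) → ℝ≥0∞} (hf : Measurable f) :
    ∫⁻ p, S.penWeight (p, q) * f p =
      ENNReal.ofReal (Real.exp (-S.β * S.V q)) * S.gaussConst *
        ∫⁻ u, f (L *ᵥ u) ∂(stdPi (Fin d)) := by
  have hβ := h.β_pos
  have hdet := (h.posDef_penMass q).det_pos
  have hK : (S.β⁻¹ • S.penMass q).PosDef := (h.posDef_penMass q).smul (inv_pos.2 hβ)
  have hinv : (S.β⁻¹ • S.penMass q)⁻¹ = S.β • (S.penMass q)⁻¹ := by
    refine Matrix.inv_eq_left_inv ?_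
    rw [Matrix.smul_mul, Matrix.mul_smul, smul_smul, mul_inv_cancel₀ hβ.ne', one_smul,
      Matrix.nonsing_inv_mul _ (h.isUnit_det_penMass q)]
  have hfix : Real.exp (-S.β * S.fixman q) = (√(S.penMass q).det)⁻¹ := by
    rw [← Real.exp_log (Real.sqrt_pos.2 hdet), ← Real.exp_neg, Real.log_sqrt hdet.le, fixman]
    congr 1
    field_simp
  have hw : ∀ p, S.penWeight (p, q) = ENNReal.ofReal (Real.exp (-S.β * S.V q) *
      (√(S.penMass q).det)⁻¹) * ENNReal.ofReal
        (Real.exp (-(1 / 2) * (p ⬝ᵥ (S.β⁻¹ • S.penMass q)⁻¹ *ᵥ p))) := by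
    intro p
    rw [penWeight, ← ENNReal.ofReal_mul (by positivity), ← hfix, ← Real.exp_add, ← Real.exp_add,
      hinv, Matrix.smul_mulVec, dotProduct_smul, smul_eq_mul, penHamiltonian]
    congr 2
    ring
  have hm : Measurable fun p : Fin d → ℝ => ENNReal.ofReal
      (Real.exp (-(1 / 2) * (p ⬝ᵥ (S.β⁻¹ • S.penMass q)⁻¹ *ᵥ p))) * f p := by
    have : Continuous fun p : Fin d → ℝ => p ⬝ᵥ (S.β⁻¹ • S.penMass q)⁻¹ *ᵥ p :=
      continuous_id.dotProduct (Continuous.matrix_mulVec continuous_const continuous_id)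
    exact (Real.continuous_exp.comp
      (continuous_const.mul this)).measurable.ennreal_ofReal.mul hf
  simp only [hw, mul_assoc]
  rw [lintegral_const_mul _ hm, lintegral_exp_neg_half_mul hK hL f hf, ← mul_assoc, ← mul_assoc,
    gaussConst, ← ENNReal.ofReal_mul (by positivity), ← ENNReal.ofReal_mul (by positivity)]
  congr 2
  rw [Matrix.det_smul, Fintype.card_fin, Real.sqrt_mul (pow_nonneg (inv_nonneg.2 hβ.le) d)]
  have := (Real.sqrt_pos.2 hdet).ne'
  generalize √((S.β⁻¹) ^ d) = b at *
  field_simp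

theorem IsAdmissible.lintegral_penWeight_mul (h : S.IsAdmissible)
    {f : (Fin d → ℝ) × (Fin d → ℝ) → ℝ≥0∞} (hf : Measurable f) :
    ∫⁻ y, S.penWeight y * f y = ∫⁻ q, ∫⁻ p, S.penWeight (p, q) * f (p, q) := by
  exact lintegral_prod_symm' _ (h.measurable_penWeight.mul hf)

/-- The partition function in position variables. -/
noncomputable def posZ (S : IMMPData d n) : ℝ≥0∞ :=
  ∫⁻ q, ENNReal.ofReal (Real.exp (-S.β * S.V q))

theorem IsAdmissible.measurable_posWeight (h : S.IsAdmissible) :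
    Measurable fun q => ENNReal.ofReal (Real.exp (-S.β * S.V q)) :=
  (Real.continuous_exp.comp
    (continuous_const.mul h.contDiff_V.continuous)).measurable.ennreal_ofReal

theorem IsAdmissible.lintegral_penWeight_snd (h : S.IsAdmissible)
    {f : (Fin d → ℝ) → ℝ≥0∞} (hf : Measurable f) :
    ∫⁻ y, S.penWeight y * f y.2 =
      S.gaussConst * ∫⁻ q, ENNReal.ofReal (Real.exp (-S.β * S.V q)) * f q := by
  rw [h.lintegral_penWeight_mul (f := fun y => f y.2) (hf.comp measurable_snd),
    ← lintegral_const_mul _ (h.measurable_posWeight.fun_mul hf)]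
  refine lintegral_congr fun q => ?_
  obtain ⟨L, hL⟩ := h.exists_sqrt_cov q
  have := h.lintegral_penWeight_fiber q hL (f := fun _ => f q) measurable_const
  simp only [this, lintegral_const, measure_univ, mul_one]
  ring

theorem IsAdmissible.lintegral_penWeight (h : S.IsAdmissible) :
    ∫⁻ y, S.penWeight y = S.gaussConst * S.posZ := by
  have := h.lintegral_penWeight_snd (f := fun _ => 1) measurable_const
  simpa [posZ] using this

theorem IsAdmissible.posZ_ne_zero (h : S.IsAdmissible) : S.posZ ≠ 0 := by
  rw [posZ, Ne, lintegral_eq_zero_iff h.measurable_posWeight]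
  intro h0
  have : ∀ q, ENNReal.ofReal (Real.exp (-S.β * S.V q)) ≠ 0 := fun q => by
    simpa using Real.exp_pos _
  have h1 : ∀ᵐ _ : Fin d → ℝ, False := h0.mono fun q hq => this q hq
  simp at h1
  exact NeZero.ne _ h1

theorem posZ_ne_top (hZ : Integrable (fun q => Real.exp (-S.β * S.V q)) volume) :
    S.posZ ≠ ∞ := by
  rw [posZ, ← ofReal_integral_eq_lintegral_ofReal hZ (.of_forall fun q => (Real.exp_pos _).le)]
  exact ENNReal.ofReal_ne_top

theorem penCanonical_eq (S : IMMPData d n) :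
    S.penCanonical = (∫⁻ y, S.penWeight y)⁻¹ • volume.withDensity S.penWeight := rfl

theorem IsAdmissible.lintegral_penCanonical (h : S.IsAdmissible)
    {f : (Fin d → ℝ) × (Fin d → ℝ) → ℝ≥0∞} (hf : Measurable f) :
    ∫⁻ y, f y ∂S.penCanonical = (S.gaussConst * S.posZ)⁻¹ * ∫⁻ y, S.penWeight y * f y := by
  rw [penCanonical_eq, lintegral_smul_measure,
    lintegral_withDensity_eq_lintegral_mul _ h.measurable_penWeight hf, h.lintegral_penWeight]
  rfl

theorem IsAdmissible.isProbabilityMeasure_penCanonical (h : S.IsAdmissible)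
    (hZ : Integrable (fun q => Real.exp (-S.β * S.V q)) volume) :
    IsProbabilityMeasure S.penCanonical := by
  constructor
  have h1 := h.lintegral_penCanonical (f := fun _ => 1) measurable_const
  simp only [lintegral_const, one_mul, mul_one, h.lintegral_penWeight] at h1
  rw [h1]
  exact ENNReal.inv_mul_cancel (mul_ne_zero h.gaussConst_ne_zero h.posZ_ne_zero)
    (ENNReal.mul_ne_top ENNReal.ofReal_ne_top (posZ_ne_top hZ))

theorem IsAdmissible.map_snd_penCanonical (h : S.IsAdmissible) :
    S.penCanonical.map Prod.snd = positionCanonical S.β S.V := by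
  refine Measure.ext_of_lintegral _ fun f hf => ?_
  have hg0 := h.gaussConst_ne_zero
  have hgt : S.gaussConst ≠ ∞ := ENNReal.ofReal_ne_top
  rw [lintegral_map hf measurable_snd, h.lintegral_penCanonical (f := fun y => f y.2) (hf.comp measurable_snd),
    h.lintegral_penWeight_snd hf, positionCanonical, lintegral_smul_measure,
    lintegral_withDensity_eq_lintegral_mul _ h.measurable_posWeight hf,
    ENNReal.mul_inv (.inl hg0) (.inl hgt), mul_comm S.gaussConst⁻¹, mul_assoc,
    ← mul_assoc _ S.gaussConst, ENNReal.inv_mul_cancel hg0 hgt, one_mul]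
  rfl

theorem IsAdmissible.lintegral_extCanonical (h : S.IsAdmissible)
    {f : ExtPhase d n → ℝ≥0∞} (hf : Measurable f) :
    ∫⁻ x, f x ∂S.extCanonical =
      (S.gaussConst * S.posZ)⁻¹ * ∫⁻ y, S.penWeight y * f (S.embed y) := by
  rw [extCanonical, lintegral_map hf h.continuous_embed.measurable,
    h.lintegral_penCanonical (f := fun y => f (S.embed y)) (hf.comp h.continuous_embed.measurable)]

/-! ### The constrained phase space in the coordinates `(p_ν, q)`. -/

/-- The impulse `p_ν = p + ν ∇ξ p_z` conjugate to the position. -/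
noncomputable def conjMomentum (S : IMMPData d n) (x : ExtPhase d n) : Fin d → ℝ :=
  x.p + S.ν • (S.gradXi x.q *ᵥ x.pz)

theorem IsAdmissible.posConstraint_embed (h : S.IsAdmissible)
    (y : (Fin d → ℝ) × (Fin d → ℝ)) : S.PosConstraint (S.embed y) := by
  simp [PosConstraint, embed, ExtPhase.q, ExtPhase.z, smul_smul, h.ν_pos.ne']

theorem penMass_mulVec (S : IMMPData d n) (q v : Fin d → ℝ) :
    S.penMass q *ᵥ v =
      S.M *ᵥ v + S.ν ^ 2 • (S.gradXi q *ᵥ (S.Mz *ᵥ ((S.gradXi q)ᵀ *ᵥ v))) := by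
  simp only [penMass, Matrix.add_mulVec, Matrix.smul_mulVec, Matrix.mulVec_mulVec,
    Matrix.mul_assoc]

/-- The velocity is `v = M⁻¹ p`; the hidden constraint then reads `M_z⁻¹ p_z = ν ∇ξᵀ v`. In this
solved form the constraint involves `v` alone as a free parameter. -/
theorem IsAdmissible.momConstraint_iff (h : S.IsAdmissible) (x : ExtPhase d n) :
    S.MomConstraint x ↔ ∃ v, x.p = S.M *ᵥ v ∧
      x.pz = S.ν • (S.Mz *ᵥ ((S.gradXi x.q)ᵀ *ᵥ v)) := by
  have hν := h.ν_pos.ne'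
  have e1 := Matrix.nonsing_inv_mul _ h.isUnit_det_M
  have e2 := Matrix.nonsing_inv_mul _ h.isUnit_det_Mz
  have e3 := Matrix.mul_nonsing_inv _ h.isUnit_det_M
  have e4 := Matrix.mul_nonsing_inv _ h.isUnit_det_Mz
  constructor
  · intro hx
    refine ⟨S.M⁻¹ *ᵥ x.p, by simp [Matrix.mulVec_mulVec, e3], ?_⟩
    rw [show _ = _ from hx, Matrix.mulVec_smul, smul_smul, Matrix.mulVec_mulVec, e4,
      mul_one_div_cancel hν, one_smul, Matrix.one_mulVec]
  · rintro ⟨v, h1, h2⟩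
    rw [MomConstraint, h1, h2, Matrix.mulVec_smul, smul_smul, one_div_mul_cancel hν, one_smul,
      Matrix.mulVec_mulVec v S.M⁻¹, Matrix.mulVec_mulVec _ S.Mz⁻¹, e1, e2]
    simp

theorem IsAdmissible.conjMomentum_eq (_ : S.IsAdmissible) {x : ExtPhase d n} {v : Fin d → ℝ}
    (h1 : x.p = S.M *ᵥ v) (h2 : x.pz = S.ν • (S.Mz *ᵥ ((S.gradXi x.q)ᵀ *ᵥ v))) :
    S.conjMomentum x = S.penMass x.q *ᵥ v := by
  rw [conjMomentum, h1, h2, penMass_mulVec, Matrix.mulVec_smul, smul_smul, pow_two]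

theorem IsAdmissible.momConstraint_embed (h : S.IsAdmissible)
    (y : (Fin d → ℝ) × (Fin d → ℝ)) : S.MomConstraint (S.embed y) :=
  (h.momConstraint_iff _).2 ⟨_, rfl, rfl⟩

theorem IsAdmissible.embed_mem (h : S.IsAdmissible) (y : (Fin d → ℝ) × (Fin d → ℝ)) :
    S.embed y ∈ S.constrainedPhase :=
  ⟨h.posConstraint_embed y, h.momConstraint_embed y⟩

theorem IsAdmissible.penMass_mul_inv_mulVec (h : S.IsAdmissible) (q p : Fin d → ℝ) :
    S.penMass q *ᵥ ((S.penMass q)⁻¹ *ᵥ p) = p := by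
  rw [Matrix.mulVec_mulVec, Matrix.mul_nonsing_inv _ (h.isUnit_det_penMass q), Matrix.one_mulVec]

theorem IsAdmissible.penMass_inv_mul_mulVec (h : S.IsAdmissible) (q p : Fin d → ℝ) :
    (S.penMass q)⁻¹ *ᵥ (S.penMass q *ᵥ p) = p := by
  rw [Matrix.mulVec_mulVec, Matrix.nonsing_inv_mul _ (h.isUnit_det_penMass q), Matrix.one_mulVec]

theorem IsAdmissible.conjMomentum_embed (h : S.IsAdmissible)
    (y : (Fin d → ℝ) × (Fin d → ℝ)) : S.conjMomentum (S.embed y) = y.1 := by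
  rw [h.conjMomentum_eq (x := S.embed y) rfl rfl]
  exact h.penMass_mul_inv_mulVec _ _

/-- With `conjMomentum_embed` and `embed_mem`, this makes `embed` a bijection onto the constrained
phase space. A constrained state is thus known from its position and `p_ν`. -/
theorem IsAdmissible.embed_conjMomentum (h : S.IsAdmissible) {x : ExtPhase d n}
    (hx : x ∈ S.constrainedPhase) : S.embed (S.conjMomentum x, x.q) = x := by
  obtain ⟨v, h1, h2⟩ := (h.momConstraint_iff x).1 hx.2
  have h0 : S.ν • S.ξ x.q = x.z := by
    rw [show _ = _ from hx.1, smul_smul, mul_one_div_cancel h.ν_pos.ne', one_smul]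
  refine Prod.ext rfl (Prod.ext h0 (Prod.ext ?_ ?_))
  · simp only [embed, h.conjMomentum_eq h1 h2, h.penMass_inv_mul_mulVec]
    exact h1.symm
  · simp only [embed, h.conjMomentum_eq h1 h2, h.penMass_inv_mul_mulVec]
    exact h2.symm

theorem flip_embed (S : IMMPData d n) (y : (Fin d → ℝ) × (Fin d → ℝ)) :
    (S.embed y).flip = S.embed (-y.1, y.2) := by
  simp [ExtPhase.flip, embed, Matrix.mulVec_neg]

theorem hamiltonian_flip (S : IMMPData d n) (x : ExtPhase d n) :
    S.hamiltonian x.flip = S.hamiltonian x := by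
  simp [ExtPhase.flip, hamiltonian, ExtPhase.q, ExtPhase.p, ExtPhase.pz, Matrix.mulVec_neg]

theorem penHamiltonian_neg (S : IMMPData d n) (p q : Fin d → ℝ) :
    S.penHamiltonian (-p) q = S.penHamiltonian p q := by
  simp [penHamiltonian, Matrix.mulVec_neg]

/-- Both kinetic energies are quadratic in the common velocity: `vᵀ M v + ν² vᵀ ∇ξ M_z ∇ξᵀ v = vᵀ
M_ν v`. The acceptance probability can therefore be computed with `H_ν`. -/
theorem IsAdmissible.hamiltonian_embed (h : S.IsAdmissible)
    (y : (Fin d → ℝ) × (Fin d → ℝ)) :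
    S.hamiltonian (S.embed y) = S.penHamiltonian y.1 y.2 := by
  have e1 := Matrix.nonsing_inv_mul _ h.isUnit_det_M
  have e2 := Matrix.nonsing_inv_mul _ h.isUnit_det_Mz
  obtain ⟨p, q⟩ := y
  set v := (S.penMass q)⁻¹ *ᵥ p with hv
  have hp : p = S.penMass q *ᵥ v := (h.penMass_mul_inv_mulVec q p).symm
  have hG : ∀ w : Fin n → ℝ, (S.gradXi q *ᵥ w) ⬝ᵥ v = w ⬝ᵥ ((S.gradXi q)ᵀ *ᵥ v) := by
    intro w
    rw [dotProduct_comm, Matrix.dotProduct_mulVec, ← Matrix.mulVec_transpose, dotProduct_comm]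
  simp only [hamiltonian, penHamiltonian, embed, ExtPhase.q, ExtPhase.p, ExtPhase.pz, ← hv]
  rw [hp]
  simp only [penMass_mulVec, add_dotProduct, smul_dotProduct, hG, Matrix.mulVec_smul,
    dotProduct_smul, Matrix.mulVec_mulVec v S.M⁻¹, Matrix.mulVec_mulVec _ S.Mz⁻¹, e1, e2,
    Matrix.one_mulVec, smul_eq_mul]
  ring

theorem IsAdmissible.measurableSet_constrainedPhase (h : S.IsAdmissible) :
    MeasurableSet S.constrainedPhase := by
  have hq : Continuous fun x : ExtPhase d n => x.q := by fun_prop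
  have hz : Continuous fun x : ExtPhase d n => x.z := by fun_prop
  have hp : Continuous fun x : ExtPhase d n => x.p := by fun_prop
  have hpz : Continuous fun x : ExtPhase d n => x.pz := by fun_prop
  refine IsClosed.measurableSet (IsClosed.inter ?_ ?_)
  · exact isClosed_eq (h.contDiff_ξ.continuous.comp hq) (continuous_const.fun_smul hz)
  · exact isClosed_eq ((h.continuous_gradXi.comp hq).matrix_transpose.matrix_mulVec
      (continuous_const.matrix_mulVec hp)) (continuous_const.fun_smul (continuous_const.matrix_mulVec hpz))

end IMMPData

/-! ### The mid-point thermostat and its reversibility. -/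

namespace IMMPData

variable {d n : ℕ} {S : IMMPData d n}

/-- The penalized dissipation matrix `γ + ν² ∇ξ γ_z ∇ξᵀ`. -/
noncomputable def penDissipation (S : IMMPData d n) (q : Fin d → ℝ) : Matrix (Fin d) (Fin d) ℝ :=
  S.γ + S.ν ^ 2 • (S.gradXi q * S.γz * (S.gradXi q)ᵀ)

/-- The implicit matrix of the mid-point scheme in the variable `q̇`. -/
noncomputable def midMass (S : IMMPData d n) (q : Fin d → ℝ) : Matrix (Fin d) (Fin d) ℝ :=
  S.penMass q + (S.δt / 2) • S.penDissipation q

theorem IsAdmissible.posDef_midMass (h : S.IsAdmissible) (q : Fin d → ℝ) :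
    (S.midMass q).PosDef := by
  refine (h.posDef_penMass q).add_posSemidef (Matrix.PosSemidef.smul ?_ (half_pos h.δt_pos).le)
  refine h.posSemidef_γ.add (Matrix.PosSemidef.smul ?_ (sq_nonneg _))
  simpa using h.posSemidef_γz.mul_mul_conjTranspose_same (S.gradXi q)

theorem IsAdmissible.isUnit_det_midMass (h : S.IsAdmissible) (q : Fin d → ℝ) :
    IsUnit (S.midMass q).det :=
  isUnit_iff_ne_zero.2 (h.posDef_midMass q).det_pos.ne'

theorem IsAdmissible.continuous_midMass_inv (h : S.IsAdmissible) :
    Continuous fun q => (S.midMass q)⁻¹ := by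
  have hG := h.continuous_gradXi
  have hc : Continuous S.midMass :=
    h.continuous_penMass.add (continuous_const.fun_smul (continuous_const.add
      (continuous_const.fun_smul ((hG.matrix_mul continuous_const).matrix_mul
        hG.matrix_transpose))))
  refine continuous_iff_continuousAt.2 fun q => ?_
  refine ContinuousAt.comp (f := S.midMass) (g := Inv.inv) ?_ hc.continuousAt
  refine continuousAt_matrix_inv _ ?_
  rw [Ring.inverse_eq_inv']
  exact continuousAt_inv₀ (h.posDef_midMass q).det_pos.ne'

/-- The explicit part of the mid-point scheme in the impulse `p`. -/
noncomputable def midRhs (S : IMMPData d n) (x : ExtPhase d n) (u : Fin d → ℝ) : Fin d → ℝ :=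
  x.p - (S.δt / 2) • (S.γ *ᵥ (S.M⁻¹ *ᵥ x.p)) + √S.δt • (S.σ *ᵥ u)

/-- The explicit part of the mid-point scheme in the impulse `p_z`. -/
noncomputable def midRhsZ (S : IMMPData d n) (x : ExtPhase d n) (u : Fin n → ℝ) : Fin n → ℝ :=
  x.pz - (S.δt / 2) • (S.γz *ᵥ (S.Mz⁻¹ *ᵥ x.pz)) + √S.δt • (S.σz *ᵥ u)

/-- The velocity reached by the mid-point scheme. -/
noncomputable def midVelocity (S : IMMPData d n) (x : ExtPhase d n)
    (u : (Fin d → ℝ) × (Fin n → ℝ)) : Fin d → ℝ :=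
  (S.midMass x.q)⁻¹ *ᵥ (S.midRhs x u.1 + S.ν • (S.gradXi x.q *ᵥ S.midRhsZ x u.2))

/-- The solution of the mid-point scheme in closed form. -/
noncomputable def midSolution (S : IMMPData d n) (x : ExtPhase d n)
    (u : (Fin d → ℝ) × (Fin n → ℝ)) : ExtPhase d n :=
  (x.q, x.z, S.M *ᵥ S.midVelocity x u,
    S.ν • (S.Mz *ᵥ ((S.gradXi x.q)ᵀ *ᵥ S.midVelocity x u)))

theorem midMass_mulVec (S : IMMPData d n) (q v : Fin d → ℝ) :
    S.midMass q *ᵥ v =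
      S.M *ᵥ v + S.ν ^ 2 • (S.gradXi q *ᵥ (S.Mz *ᵥ ((S.gradXi q)ᵀ *ᵥ v))) +
        (S.δt / 2) • (S.γ *ᵥ v + S.ν ^ 2 • (S.gradXi q *ᵥ (S.γz *ᵥ ((S.gradXi q)ᵀ *ᵥ v)))) := by
  simp only [midMass, penMass, penDissipation, Matrix.add_mulVec, Matrix.smul_mulVec,
    Matrix.mulVec_mulVec, Matrix.mul_assoc]

/-- Adding `ν ∇ξ` times the `p_z` equation to the `p` equation eliminates the multiplier and leaves
a linear system for the new velocity, with the positive definite matrix `midMass`. The `p_z`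
equation then determines the multiplier. The initial state may violate the constraints. -/
theorem IsAdmissible.isMidpointStep_iff (h : S.IsAdmissible) (x y : ExtPhase d n)
    (u : (Fin d → ℝ) × (Fin n → ℝ)) : S.IsMidpointStep x u y ↔ y = S.midSolution x u := by
  have hν := h.ν_pos.ne'
  have e1 := Matrix.nonsing_inv_mul _ h.isUnit_det_M
  have e2 := Matrix.nonsing_inv_mul _ h.isUnit_det_Mz
  have hN := h.isUnit_det_midMass x.q
  have ep : ∀ v : Fin d → ℝ,
      x.p - (S.δt / 2) • (S.γ *ᵥ (S.M⁻¹ *ᵥ (x.p + S.M *ᵥ v))) + √S.δt • (S.σ *ᵥ u.1) =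
        S.midRhs x u.1 - (S.δt / 2) • (S.γ *ᵥ v) := by
    intro v
    simp only [midRhs, Matrix.mulVec_add, Matrix.mulVec_mulVec v, e1, Matrix.one_mulVec, smul_add]
    abel
  have ez : ∀ w : Fin n → ℝ,
      x.pz - (S.δt / 2) • (S.γz *ᵥ (S.Mz⁻¹ *ᵥ (x.pz + S.ν • (S.Mz *ᵥ w)))) +
          √S.δt • (S.σz *ᵥ u.2) =
        S.midRhsZ x u.2 - (S.δt / 2 * S.ν) • (S.γz *ᵥ w) := by
    intro w
    simp only [midRhsZ, Matrix.mulVec_add, Matrix.mulVec_smul, Matrix.mulVec_mulVec w, e2,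
      Matrix.one_mulVec, smul_add, smul_smul]
    abel
  constructor
  · rintro ⟨l, hq, hz, hp, hpz, hm⟩
    obtain ⟨v, hv, hvz⟩ := (h.momConstraint_iff y).1 hm
    rw [hq] at hvz
    rw [hv, ep] at hp
    rw [hvz, ez] at hpz
    have hv' : v = S.midVelocity x u := by
      rw [midVelocity, ← Matrix.one_mulVec v, ← Matrix.nonsing_inv_mul _ hN,
        ← Matrix.mulVec_mulVec, midMass_mulVec]
      congr 1
      have hG := congrArg (fun w => S.ν • (S.gradXi x.q *ᵥ w)) hpz
      simp only [Matrix.mulVec_add, Matrix.mulVec_sub, Matrix.mulVec_smul, smul_add, smul_sub,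
        smul_smul, mul_one_div_cancel hν, one_smul] at hG
      rw [hp, pow_two, hG]
      module
    rw [midSolution, ← hv', ← hv, ← hvz, ← hq, ← hz]
  · rintro rfl
    set v := S.midVelocity x u with hv
    have hNv : S.midMass x.q *ᵥ v =
        S.midRhs x u.1 + S.ν • (S.gradXi x.q *ᵥ S.midRhsZ x u.2) := by
      rw [hv, midVelocity, Matrix.mulVec_mulVec, Matrix.mul_nonsing_inv _ hN, Matrix.one_mulVec]
    rw [midMass_mulVec] at hNv
    -- The multiplier is read off from the `p_z` equation.
    refine ⟨S.ν • (S.ν • (S.Mz *ᵥ ((S.gradXi x.q)ᵀ *ᵥ v)) - S.midRhsZ x u.2 +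
      (S.δt / 2 * S.ν) • (S.γz *ᵥ ((S.gradXi x.q)ᵀ *ᵥ v))), rfl, rfl, ?_, ?_,
      (h.momConstraint_iff _).2 ⟨v, rfl, rfl⟩⟩
    · change S.M *ᵥ v = x.p - (S.δt / 2) • (S.γ *ᵥ (S.M⁻¹ *ᵥ (x.p + S.M *ᵥ v))) +
        √S.δt • (S.σ *ᵥ u.1) - _
      rw [ep]
      simp only [Matrix.mulVec_add, Matrix.mulVec_sub, Matrix.mulVec_smul]
      have h2 : S.midRhs x u.1 = S.M *ᵥ v +
          S.ν ^ 2 • (S.gradXi x.q *ᵥ (S.Mz *ᵥ ((S.gradXi x.q)ᵀ *ᵥ v))) +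
          (S.δt / 2) • (S.γ *ᵥ v +
            S.ν ^ 2 • (S.gradXi x.q *ᵥ (S.γz *ᵥ ((S.gradXi x.q)ᵀ *ᵥ v)))) -
          S.ν • (S.gradXi x.q *ᵥ S.midRhsZ x u.2) := by
        rw [hNv]; abel
      rw [h2]
      module
    · change S.ν • (S.Mz *ᵥ ((S.gradXi x.q)ᵀ *ᵥ v)) = x.pz - (S.δt / 2) •
        (S.γz *ᵥ (S.Mz⁻¹ *ᵥ (x.pz + S.ν • (S.Mz *ᵥ ((S.gradXi x.q)ᵀ *ᵥ v))))) +
          √S.δt • (S.σz *ᵥ u.2) + _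
      rw [ez, smul_smul, one_div_mul_cancel hν, one_smul]
      abel

theorem IsAdmissible.existsUnique_isMidpointStep (h : S.IsAdmissible) (x : ExtPhase d n)
    (u : (Fin d → ℝ) × (Fin n → ℝ)) : ∃! y, S.IsMidpointStep x u y :=
  ⟨S.midSolution x u, (h.isMidpointStep_iff _ _ _).2 rfl,
    fun _ hy => (h.isMidpointStep_iff _ _ _).1 hy⟩

theorem IsAdmissible.midpointStep_eq (h : S.IsAdmissible) : S.midpointStep = S.midSolution := by
  ext1 x
  ext1 u
  exact (h.isMidpointStep_iff _ _ _).1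
    (Classical.epsilon_spec (h.existsUnique_isMidpointStep x u).exists)

theorem IsAdmissible.measurable_midSolution (h : S.IsAdmissible) :
    Measurable fun w : ExtPhase d n × (Fin d → ℝ) × (Fin n → ℝ) => S.midSolution w.1 w.2 := by
  have hq : Continuous fun w : ExtPhase d n × (Fin d → ℝ) × (Fin n → ℝ) => w.1.q := by fun_prop
  have hz : Continuous fun w : ExtPhase d n × (Fin d → ℝ) × (Fin n → ℝ) => w.1.z := by fun_prop
  have hp : Continuous fun w : ExtPhase d n × (Fin d → ℝ) × (Fin n → ℝ) => w.1.p := by fun_prop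
  have hpz : Continuous fun w : ExtPhase d n × (Fin d → ℝ) × (Fin n → ℝ) => w.1.pz := by
    fun_prop
  have hu : Continuous fun w : ExtPhase d n × (Fin d → ℝ) × (Fin n → ℝ) => w.2.1 := by fun_prop
  have huz : Continuous fun w : ExtPhase d n × (Fin d → ℝ) × (Fin n → ℝ) => w.2.2 := by fun_prop
  have hG := h.continuous_gradXi.comp hq
  have hr : Continuous fun w : ExtPhase d n × (Fin d → ℝ) × (Fin n → ℝ) =>
      S.midRhs w.1 w.2.1 :=
    (hp.sub (continuous_const.fun_smul (continuous_const.matrix_mulVec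
      (continuous_const.matrix_mulVec hp)))).add
      (continuous_const.fun_smul (continuous_const.matrix_mulVec hu))
  have hrz : Continuous fun w : ExtPhase d n × (Fin d → ℝ) × (Fin n → ℝ) =>
      S.midRhsZ w.1 w.2.2 :=
    (hpz.sub (continuous_const.fun_smul (continuous_const.matrix_mulVec
      (continuous_const.matrix_mulVec hpz)))).add
      (continuous_const.fun_smul (continuous_const.matrix_mulVec huz))
  have hv : Continuous fun w : ExtPhase d n × (Fin d → ℝ) × (Fin n → ℝ) =>
      S.midVelocity w.1 w.2 :=
    (h.continuous_midMass_inv.comp hq).matrix_mulVec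
      (hr.add (continuous_const.fun_smul (hG.matrix_mulVec hrz)))
  exact (hq.prodMk (hz.prodMk ((continuous_const.matrix_mulVec hv).prodMk
    (continuous_const.fun_smul (continuous_const.matrix_mulVec
      (hG.matrix_transpose.matrix_mulVec hv)))))).measurable

/-- The matrix of the mid-point scheme in the impulse `p_ν`. -/
noncomputable def midMatrix (S : IMMPData d n) (q : Fin d → ℝ) : Matrix (Fin d) (Fin d) ℝ :=
  (2 : ℝ) • (S.penMass q * (S.midMass q)⁻¹) - 1

/-- The noise matrix, for `U`, of the mid-point scheme in the impulse `p_ν`. -/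
noncomputable def midNoise (S : IMMPData d n) (q : Fin d → ℝ) : Matrix (Fin d) (Fin d) ℝ :=
  √S.δt • (S.penMass q * (S.midMass q)⁻¹ * S.σ)

/-- The noise matrix, for `U_z`, of the mid-point scheme in the impulse `p_ν`. -/
noncomputable def midNoiseZ (S : IMMPData d n) (q : Fin d → ℝ) : Matrix (Fin d) (Fin n) ℝ :=
  (√S.δt * S.ν) • (S.penMass q * (S.midMass q)⁻¹ * (S.gradXi q * S.σz))

theorem IsAdmissible.midSolution_embed (h : S.IsAdmissible) (p q : Fin d → ℝ)
    (u : (Fin d → ℝ) × (Fin n → ℝ)) :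
    S.midSolution (S.embed (p, q)) u =
      S.embed (S.midMatrix q *ᵥ p + (S.midNoise q *ᵥ u.1 + S.midNoiseZ q *ᵥ u.2), q) := by
  have e1 := Matrix.nonsing_inv_mul _ h.isUnit_det_M
  have e2 := Matrix.nonsing_inv_mul _ h.isUnit_det_Mz
  have hN := h.isUnit_det_midMass q
  have hv : S.midVelocity (S.embed (p, q)) u = (S.penMass q)⁻¹ *ᵥ
      (S.midMatrix q *ᵥ p + (S.midNoise q *ᵥ u.1 + S.midNoiseZ q *ᵥ u.2)) := by
    set v := (S.penMass q)⁻¹ *ᵥ p with hv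
    have hp : p = S.penMass q *ᵥ v := (h.penMass_mul_inv_mulVec q p).symm
    -- The explicit half of the dissipation gives `M_ν v - (δt/2) Γ v`, with `Γ = penDissipation`.
    -- Since `midMass = M_ν + (δt/2) Γ` and `p = M_ν v`, this is `2 p - midMass v`, whence the form
    -- of `midMatrix`.
    have h1 : S.midMatrix q *ᵥ p + (S.midNoise q *ᵥ u.1 + S.midNoiseZ q *ᵥ u.2) =
        S.penMass q *ᵥ ((S.midMass q)⁻¹ *ᵥ ((2 : ℝ) • p - S.midMass q *ᵥ v +
          √S.δt • (S.σ *ᵥ u.1) + (√S.δt * S.ν) • (S.gradXi q *ᵥ (S.σz *ᵥ u.2)))) := by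
      simp only [Matrix.mulVec_add, Matrix.mulVec_sub, Matrix.mulVec_smul,
        Matrix.mulVec_mulVec v, Matrix.nonsing_inv_mul _ hN, Matrix.one_mulVec, ← hp]
      simp only [midMatrix, midNoise, midNoiseZ, Matrix.sub_mulVec, Matrix.smul_mulVec,
        Matrix.one_mulVec, Matrix.mulVec_mulVec, Matrix.mul_assoc]
      abel
    rw [h1, h.penMass_inv_mul_mulVec, midVelocity]
    change (S.midMass q)⁻¹ *ᵥ (_ + S.ν • (S.gradXi q *ᵥ _)) = _
    congr 1
    simp only [midRhs, midRhsZ, embed, ExtPhase.p, ExtPhase.pz, ← hv]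
    rw [midMass_mulVec, hp, penMass_mulVec]
    simp only [Matrix.mulVec_add, Matrix.mulVec_sub, Matrix.mulVec_smul,
      Matrix.mulVec_mulVec v S.M⁻¹, Matrix.mulVec_mulVec _ S.Mz⁻¹, e1, e2, Matrix.one_mulVec]
    module
  rw [midSolution, hv]
  rfl

/-- With `M = M_ν` and `N = midMass`, `A M = 2 M N⁻¹ M - M` is symmetric. Up to `β⁻¹`, `A M Aᵀ`
equals `M - 4 M N⁻¹ (N - M) N⁻¹ M`, and the noise supplies exactly the missing term. -/
theorem IsAdmissible.midpoint_covariance (h : S.IsAdmissible) (q : Fin d → ℝ) :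
    S.midMatrix q * (S.β⁻¹ • S.penMass q) = (S.β⁻¹ • S.penMass q) * (S.midMatrix q)ᵀ ∧
    S.midMatrix q * (S.β⁻¹ • S.penMass q) * (S.midMatrix q)ᵀ +
      (S.midNoise q * (S.midNoise q)ᵀ + S.midNoiseZ q * (S.midNoiseZ q)ᵀ) =
      S.β⁻¹ • S.penMass q := by
  have hN := h.isUnit_det_midMass q
  have hMt : (S.penMass q)ᵀ = S.penMass q := by
    simpa using (h.posDef_penMass q).isHermitian.eq
  have hNt : (S.midMass q)⁻¹ᵀ = (S.midMass q)⁻¹ := by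
    rw [Matrix.transpose_nonsing_inv]
    congr 1
    simpa using (h.posDef_midMass q).isHermitian.eq
  have hδ : √S.δt * √S.δt = S.δt := Real.mul_self_sqrt h.δt_pos.le
  -- Fluctuation-dissipation yields `δt (2/β) Γ` between the outer factors, and `δt Γ = 2 (midMass -
  -- M_ν)`; hence the constant `4/β`.
  have hnoise : S.midNoise q * (S.midNoise q)ᵀ + S.midNoiseZ q * (S.midNoiseZ q)ᵀ =
      (4 * S.β⁻¹) • (S.penMass q * (S.midMass q)⁻¹ * (S.midMass q - S.penMass q) *
        ((S.midMass q)⁻¹ * S.penMass q)) := by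
    have h1 : S.midMass q - S.penMass q = (S.δt / 2) • S.penDissipation q := by
      rw [midMass, add_sub_cancel_left]
    have h2 : S.midNoise q * (S.midNoise q)ᵀ = S.δt • (S.penMass q * (S.midMass q)⁻¹ *
        (S.σ * S.σᵀ) * ((S.midMass q)⁻¹ * S.penMass q)) := by
      simp only [midNoise, Matrix.transpose_smul, Matrix.transpose_mul, hMt, hNt, Matrix.smul_mul,
        Matrix.mul_smul, smul_smul, hδ, Matrix.mul_assoc]
    have h3 : S.midNoiseZ q * (S.midNoiseZ q)ᵀ = (S.δt * S.ν ^ 2) • (S.penMass q *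
        (S.midMass q)⁻¹ * (S.gradXi q * (S.σz * S.σzᵀ) * (S.gradXi q)ᵀ) *
          ((S.midMass q)⁻¹ * S.penMass q)) := by
      have : √S.δt * S.ν * (√S.δt * S.ν) = S.δt * S.ν ^ 2 := by
        rw [← hδ]; ring_nf; simp
      simp only [midNoiseZ, Matrix.transpose_smul, Matrix.transpose_mul, hMt, hNt, Matrix.smul_mul,
        Matrix.mul_smul, smul_smul, this, Matrix.mul_assoc]
    rw [h2, h3, h1, h.σ_mul, h.σz_mul, penDissipation]
    simp only [Matrix.mul_smul, Matrix.smul_mul, Matrix.mul_add, Matrix.add_mul, smul_smul,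
      smul_add, Matrix.mul_assoc]
    congr 2 <;> ring
  rw [hnoise]
  set M := S.penMass q
  set N := S.midMass q
  have hNN : N⁻¹ * N = 1 := Matrix.nonsing_inv_mul _ hN
  have hA : S.midMatrix q = (2 : ℝ) • (M * N⁻¹) - 1 := rfl
  have hAt : (S.midMatrix q)ᵀ = (2 : ℝ) • (N⁻¹ * M) - 1 := by
    rw [hA, Matrix.transpose_sub, Matrix.transpose_smul, Matrix.transpose_mul, hNt, hMt,
      Matrix.transpose_one]
  have hNX : ∀ X : Matrix (Fin d) (Fin d) ℝ, N⁻¹ * (N * X) = X := fun X => by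
    rw [← Matrix.mul_assoc, hNN, Matrix.one_mul]
  rw [hAt, hA]
  constructor
  · simp only [Matrix.sub_mul, Matrix.mul_sub, Matrix.smul_mul, Matrix.mul_smul, Matrix.one_mul,
      Matrix.mul_one, Matrix.mul_assoc]
    module
  · simp only [Matrix.sub_mul, Matrix.mul_sub, Matrix.smul_mul, Matrix.mul_smul, Matrix.one_mul,
      Matrix.mul_one, Matrix.mul_assoc, hNX]
    module

/-- The law of the noise `(U, U_z)`. -/
noncomputable abbrev noise (d n : ℕ) : Measure ((Fin d → ℝ) × (Fin n → ℝ)) :=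
  (stdPi (Fin d)).prod (stdPi (Fin n))

theorem IsAdmissible.thermostatLaw_apply (h : S.IsAdmissible) (x : ExtPhase d n)
    {B : Set (ExtPhase d n)} (hB : MeasurableSet B) :
    S.thermostatLaw x B = noise d n {u | S.midSolution x u ∈ B} := by
  have hm : Measurable (S.midSolution x) := h.measurable_midSolution.comp measurable_prodMk_left
  rw [thermostatLaw, h.midpointStep_eq, Measure.map_apply hm hB]
  rfl

/-- Step 3 of the scheme as a Markov kernel. -/
noncomputable def IsAdmissible.thermostatKernel (h : S.IsAdmissible) :
    Kernel (ExtPhase d n) (ExtPhase d n) where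
  toFun := S.thermostatLaw
  measurable' := by
    refine Measure.measurable_of_measurable_coe _ fun B hB => ?_
    simp only [h.thermostatLaw_apply _ hB]
    exact measurable_measure_prodMk_left (h.measurable_midSolution hB)

theorem IsAdmissible.thermostatKernel_apply (h : S.IsAdmissible) (x : ExtPhase d n) :
    h.thermostatKernel x = S.thermostatLaw x := rfl

instance IsAdmissible.isMarkovKernel_thermostatKernel (h : S.IsAdmissible) :
    IsMarkovKernel h.thermostatKernel := by
  refine ⟨fun x => ⟨?_⟩⟩
  rw [h.thermostatKernel_apply, h.thermostatLaw_apply x .univ]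
  simp

theorem IsAdmissible.isReversible_thermostatKernel (h : S.IsAdmissible) :
    h.thermostatKernel.IsReversible S.extCanonical := by
  have hstep : ∀ {A B : Set (ExtPhase d n)}, MeasurableSet A → MeasurableSet B →
      ∫⁻ x in A, h.thermostatKernel x B ∂S.extCanonical = (S.gaussConst * S.posZ)⁻¹ *
        ∫⁻ q, ∫⁻ p, S.penWeight (p, q) *
          (A.indicator (fun x => h.thermostatKernel x B) (S.embed (p, q))) := by
    intro A B hA hB
    have hm : Measurable (A.indicator fun x => h.thermostatKernel x B) :=
      (h.thermostatKernel.measurable_coe hB).indicator hA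
    rw [← lintegral_indicator hA, h.lintegral_extCanonical hm,
      h.lintegral_penWeight_mul
        (f := fun y => A.indicator (fun x => h.thermostatKernel x B) (S.embed y))
        (hm.comp h.continuous_embed.measurable)]
  intro A B hA hB
  rw [hstep hA hB, hstep hB hA]
  congr 1
  refine lintegral_congr fun q => ?_
  -- The square root is chosen inside a single fibre, so its dependence on `q` need not be
  -- measurable.
  obtain ⟨L, hL⟩ := h.exists_sqrt_cov q
  have hE : Measurable fun p => S.embed (p, q) :=
    h.continuous_embed.measurable.comp measurable_prodMk_right
  have hLm : Measurable fun u : Fin d → ℝ => L *ᵥ u :=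
    (Continuous.matrix_mulVec continuous_const continuous_id).measurable
  have hT : Measurable fun w : (Fin d → ℝ) × (Fin d → ℝ) × (Fin n → ℝ) =>
      S.midMatrix q *ᵥ (L *ᵥ w.1) + (S.midNoise q *ᵥ w.2.1 + S.midNoiseZ q *ᵥ w.2.2) := by
    refine Continuous.measurable ?_
    refine (continuous_const.matrix_mulVec (continuous_const.matrix_mulVec continuous_fst)).fun_add
      ((continuous_const.matrix_mulVec ?_).fun_add (continuous_const.matrix_mulVec ?_)) <;> fun_prop
  have hLm' : Measurable fun w : (Fin d → ℝ) × (Fin d → ℝ) × (Fin n → ℝ) => L *ᵥ w.1 :=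
    hLm.comp measurable_fst
  -- The flow from `A` to `B` over `q` is, up to a constant, the probability that the Gaussian pair
  -- (current impulse, next impulse) lies in a rectangle; exchanging the pair exchanges `A` and `B`.
  have hfib : ∀ {A B : Set (ExtPhase d n)}, MeasurableSet A → MeasurableSet B →
      ∫⁻ p, S.penWeight (p, q) *
          (A.indicator (fun x => h.thermostatKernel x B) (S.embed (p, q))) =
        ENNReal.ofReal (Real.exp (-S.β * S.V q)) * S.gaussConst *
          ((stdPi (Fin d)).prod (noise d n)).map (fun w => (L *ᵥ w.1,
            S.midMatrix q *ᵥ (L *ᵥ w.1) + (S.midNoise q *ᵥ w.2.1 + S.midNoiseZ q *ᵥ w.2.2)))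
              (((fun p => S.embed (p, q)) ⁻¹' A) ×ˢ ((fun p => S.embed (p, q)) ⁻¹' B)) := by
    intro A B hA hB
    have hm : Measurable (A.indicator fun x => h.thermostatKernel x B) :=
      (h.thermostatKernel.measurable_coe hB).indicator hA
    have hset := (hLm'.prodMk hT) ((hE hA).prod (hE hB))
    rw [h.lintegral_penWeight_fiber q hL
        (f := fun p => A.indicator (fun x => h.thermostatKernel x B) (S.embed (p, q)))
        (hm.comp hE),
      Measure.map_apply (hLm'.prodMk hT) ((hE hA).prod (hE hB)), Measure.prod_apply hset]
    congr 1
    refine lintegral_congr fun u => ?_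
    by_cases hu : S.embed (L *ᵥ u, q) ∈ A
    · rw [Set.indicator_of_mem hu, h.thermostatKernel_apply, h.thermostatLaw_apply _ hB]
      congr 1
      ext w
      simp [h.midSolution_embed, hu]
    · rw [Set.indicator_of_notMem hu]
      symm
      convert measure_empty (μ := noise d n)
      ext w
      simp [hu]
  obtain ⟨hc1, hc2⟩ := h.midpoint_covariance q
  have hswap := map_gaussian_pair_swap (S.β⁻¹ • S.penMass q) L (S.midMatrix q) (S.midNoise q)
    (S.midNoiseZ q) hL hc1 hc2
  rw [hfib hA hB, hfib hB hA]
  conv_lhs => rw [hswap]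
  rw [Measure.map_apply (hT.prodMk hLm') ((hE hA).prod (hE hB)),
    Measure.map_apply (hLm'.prodMk hT) ((hE hB).prod (hE hA))]
  congr 2
  ext w
  simp [and_comm]

end IMMPData

/-! ### Measure preservation from a symmetric Jacobian. -/

section ChangeOfVariables

variable {d : ℕ}

/-- Fibrewise change of variables `p = α q q'` in the first variable of `(p, q)`. -/
theorem setLIntegral_eq_lintegral_fiberwise {α : (Fin d → ℝ) → (Fin d → ℝ) → (Fin d → ℝ)}
    {J : (Fin d → ℝ) → (Fin d → ℝ) → ((Fin d → ℝ) →L[ℝ] (Fin d → ℝ))}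
    (hJ : ∀ q q', HasFDerivAt (α q) (J q q') q')
    {E : Set ((Fin d → ℝ) × (Fin d → ℝ))} (hE : MeasurableSet E)
    (hsol : ∀ y ∈ E, ∃! q', α y.2 q' = y.1)
    {k : (Fin d → ℝ) × (Fin d → ℝ) → ℝ≥0∞} (hk : Measurable k) :
    ∫⁻ y in E, k y = ∫⁻ q, ∫⁻ q', {w : (Fin d → ℝ) × (Fin d → ℝ) | (α w.1 w.2, w.1) ∈ E}.indicator
      (fun w => ENNReal.ofReal |(J w.1 w.2).det| * k (α w.1 w.2, w.1)) (q, q') := by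
  rw [← lintegral_indicator hE, Measure.volume_eq_prod, lintegral_prod_symm' _ (hk.indicator hE)]
  refine lintegral_congr fun q => ?_
  have hα : Measurable (α q) :=
    (continuous_iff_continuousAt.2 fun q' => (hJ q q').continuousAt).measurable
  have hEq : MeasurableSet {p | (p, q) ∈ E} := measurable_prodMk_right hE
  have hWq : MeasurableSet {q' | (α q q', q) ∈ E} := hα hEq
  -- Unique solvability makes `α q` a bijection onto the fibre of `E`; the change of variables then
  -- asks for no invertibility of the Jacobian.
  have hinj : Set.InjOn (α q) {q' | (α q q', q) ∈ E} := fun a ha b _ hab =>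
    (hsol _ ha).unique rfl hab.symm
  have himage : α q '' {q' | (α q q', q) ∈ E} = {p | (p, q) ∈ E} := by
    ext p
    constructor
    · rintro ⟨q', hq', rfl⟩
      exact hq'
    · intro hp
      obtain ⟨q', hq', -⟩ := hsol _ hp
      refine ⟨q', ?_, hq'⟩
      change (α q q', q) ∈ E
      have hq'' : α q q' = p := hq'
      rwa [hq'']
  have hcv := lintegral_image_eq_lintegral_abs_det_fderiv_mul volume hWq
    (fun q' _ => (hJ q q').hasFDerivWithinAt) hinj (fun p => k (p, q))
  rw [himage, ← lintegral_indicator hEq, ← lintegral_indicator hWq] at hcv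
  exact hcv

/-- If the Jacobian of `α q` at `q'` is symmetric in `(q, q')`, the involution exchanging
`(α q q', q)` and `(α q' q, q')` preserves the Lebesgue measure. -/
theorem setLIntegral_eq_of_symmetric_generating {α : (Fin d → ℝ) → (Fin d → ℝ) → (Fin d → ℝ)}
    {J : (Fin d → ℝ) → (Fin d → ℝ) → ((Fin d → ℝ) →L[ℝ] (Fin d → ℝ))}
    (hJ : ∀ q q', HasFDerivAt (α q) (J q q') q')
    (hα : Measurable fun w : (Fin d → ℝ) × (Fin d → ℝ) => α w.1 w.2)
    (hdet : Measurable fun w : (Fin d → ℝ) × (Fin d → ℝ) => (J w.1 w.2).det)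
    (hsymm : ∀ q q', (J q q').det = (J q' q).det)
    {E : Set ((Fin d → ℝ) × (Fin d → ℝ))} (hE : MeasurableSet E)
    (hsol : ∀ y ∈ E, ∃! q', α y.2 q' = y.1)
    (hswap : ∀ q q', (α q q', q) ∈ E → (α q' q, q') ∈ E)
    {k₁ k₂ : (Fin d → ℝ) × (Fin d → ℝ) → ℝ≥0∞} (hk₁ : Measurable k₁) (hk₂ : Measurable k₂)
    (hk : ∀ q q', (α q q', q) ∈ E → k₁ (α q q', q) = k₂ (α q' q, q')) :
    ∫⁻ y in E, k₁ y = ∫⁻ y in E, k₂ y := by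
  rw [setLIntegral_eq_lintegral_fiberwise hJ hE hsol hk₁,
    setLIntegral_eq_lintegral_fiberwise hJ hE hsol hk₂]
  have hA : Measurable fun w : (Fin d → ℝ) × (Fin d → ℝ) => (α w.1 w.2, w.1) :=
    hα.prodMk measurable_fst
  have hm : Measurable ({w : (Fin d → ℝ) × (Fin d → ℝ) | (α w.1 w.2, w.1) ∈ E}.indicator
      (fun w => ENNReal.ofReal |(J w.1 w.2).det| * k₁ (α w.1 w.2, w.1))) :=
    ((continuous_abs.measurable.comp hdet).ennreal_ofReal.mul (hk₁.comp hA)).indicator (hA hE)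
  -- In the variables `(q, q')` the involution is the exchange of the two positions, so Tonelli's
  -- theorem performs it.
  rw [lintegral_lintegral_swap (f := fun q q' => {w : (Fin d → ℝ) × (Fin d → ℝ) |
    (α w.1 w.2, w.1) ∈ E}.indicator (fun w => ENNReal.ofReal |(J w.1 w.2).det| *
      k₁ (α w.1 w.2, w.1)) (q, q')) hm.aemeasurable]
  refine lintegral_congr fun q' => lintegral_congr fun q => ?_
  by_cases hw : (α q q', q) ∈ E
  · rw [Set.indicator_of_mem (by exact hw), Set.indicator_of_mem (by exact hswap _ _ hw)]
    simp only
    rw [hk _ _ hw, hsymm q q']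
  · rw [Set.indicator_of_notMem (by exact hw),
      Set.indicator_of_notMem (by exact fun h => hw (hswap _ _ h))]

end ChangeOfVariables

/-! ### Measurability of implicitly defined maps. -/

section Graph

/-- A function whose graph over a measurable set `s` is cut out by a measurable relation with unique
solutions is measurable on `s`. -/
theorem measurableSet_inter_preimage_of_existsUnique {X Y : Type*} [MeasurableSpace X]
    [StandardBorelSpace X] [MeasurableSpace Y] [StandardBorelSpace Y] {r : X → Y → Prop}
    (hr : MeasurableSet {w : X × Y | r w.1 w.2}) {s : Set X} (hs : MeasurableSet s)
    (hu : ∀ x ∈ s, ∃! y, r x y) {f : X → Y} (hf : ∀ x ∈ s, r x (f x)) {B : Set Y}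
    (hB : MeasurableSet B) : MeasurableSet (s ∩ f ⁻¹' B) := by
  -- By uniqueness the projection is injective on this piece of the graph, so the Lusin-Souslin
  -- theorem makes its image measurable.
  have h : s ∩ f ⁻¹' B = Prod.fst '' ({w : X × Y | r w.1 w.2} ∩ s ×ˢ B) := by
    ext x
    constructor
    · rintro ⟨hx, hB⟩
      exact ⟨(x, f x), ⟨hf x hx, hx, hB⟩, rfl⟩
    · rintro ⟨⟨x, y⟩, ⟨hxy, hx, hy⟩, rfl⟩
      refine ⟨hx, ?_⟩
      change f x ∈ B
      rwa [(hu x hx).unique (hf x hx) hxy]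
  rw [h]
  refine MeasurableSet.image_of_measurable_injOn (hr.inter (hs.prod hB)) measurable_fst ?_
  rintro ⟨x, y⟩ ⟨hxy, hx, -⟩ ⟨x', y'⟩ ⟨hxy', -, -⟩ (rfl : x = x')
  exact Prod.ext rfl ((hu x hx).unique hxy hxy')

end Graph

/-! ### The leapfrog step in the coordinates `(p_ν, q)`. -/

namespace IMMPData

variable {d n : ℕ} {S : IMMPData d n}

/-- The derivative of an arbitrary function is measurable in the base point. Measurability is all
that the argument asks of the force. -/
theorem measurable_gradient' (f : (Fin d → ℝ) → ℝ) : Measurable (gradient' f) :=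
  measurable_pi_lambda _ fun _ => measurable_fderiv_apply_const ℝ f _

theorem measurable_gradPot (S : IMMPData d n) : Measurable S.gradPot :=
  (measurable_gradient' _).add (measurable_gradient' _)

/-- The impulse `p_ν` at `q` from which the leapfrog step leads to `q'`. -/
noncomputable def discImpulse (S : IMMPData d n) (q q' : Fin d → ℝ) : Fin d → ℝ :=
  (1 / S.δt) • (S.M *ᵥ (q' - q) +
    S.ν ^ 2 • (S.gradXi q *ᵥ (S.Mz *ᵥ (S.ξ q' - S.ξ q)))) + (S.δt / 2) • S.gradPot q

/-- The Jacobian matrix of `discImpulse` in its second variable. -/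
noncomputable def discMass (S : IMMPData d n) (q q' : Fin d → ℝ) : Matrix (Fin d) (Fin d) ℝ :=
  (1 / S.δt) • (S.M + S.ν ^ 2 • (S.gradXi q * S.Mz * (S.gradXi q')ᵀ))

/-- Transposition exchanges `q` and `q'`, because `M` and `M_z` are symmetric. This is the
symplecticity of the scheme: `discMass` is, up to sign, the mixed second derivative of a discrete
Lagrangian symmetric in its endpoints. -/
theorem IsAdmissible.det_discMass_comm (h : S.IsAdmissible) (q q' : Fin d → ℝ) :
    (S.discMass q q').det = (S.discMass q' q).det := by
  have h1 : S.Mᵀ = S.M := by simpa using h.posDef_M.isHermitian.eq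
  have h2 : S.Mzᵀ = S.Mz := by simpa using h.posDef_Mz.isHermitian.eq
  rw [← Matrix.det_transpose (S.discMass q q')]
  simp only [discMass, Matrix.transpose_smul, Matrix.transpose_add, Matrix.transpose_mul,
    Matrix.transpose_transpose, h1, h2, Matrix.mul_assoc]

theorem IsAdmissible.fderiv_ξ_apply (_ : S.IsAdmissible) (q v : Fin d → ℝ) :
    fderiv ℝ S.ξ q v = (S.gradXi q)ᵀ *ᵥ v := by
  have hx : v = ∑ i, v i • (Pi.single i 1 : Fin d → ℝ) := by
    ext j
    simp [Finset.sum_apply, Pi.single_apply]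
  conv_lhs => rw [hx]
  ext j
  simp [gradXi, Matrix.mulVec, dotProduct, mul_comm]

/-- With `q` fixed, the force is an additive constant and `∇ξ(q)` a constant matrix, so only `ξ`
itself is differentiated. -/
theorem IsAdmissible.hasFDerivAt_discImpulse (h : S.IsAdmissible) (q q' : Fin d → ℝ) :
    HasFDerivAt (S.discImpulse q)
      (LinearMap.toContinuousLinearMap (S.discMass q q').mulVecLin) q' := by
  have h1 : HasFDerivAt (fun q' => S.M *ᵥ (q' - q))
      ((LinearMap.toContinuousLinearMap S.M.mulVecLin).comp
        (ContinuousLinearMap.id ℝ (Fin d → ℝ))) q' :=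
    (LinearMap.toContinuousLinearMap S.M.mulVecLin).hasFDerivAt.comp q'
      ((hasFDerivAt_id q').sub_const q)
  have h2 : HasFDerivAt (fun q' => S.gradXi q *ᵥ (S.Mz *ᵥ (S.ξ q' - S.ξ q)))
      ((LinearMap.toContinuousLinearMap (S.gradXi q).mulVecLin).comp
        ((LinearMap.toContinuousLinearMap S.Mz.mulVecLin).comp (fderiv ℝ S.ξ q'))) q' :=
    (LinearMap.toContinuousLinearMap (S.gradXi q).mulVecLin).hasFDerivAt.comp q'
      ((LinearMap.toContinuousLinearMap S.Mz.mulVecLin).hasFDerivAt.comp q'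
        ((h.differentiable_ξ q').hasFDerivAt.sub_const _))
  refine (((h1.add (h2.const_smul (S.ν ^ 2))).const_smul (1 / S.δt)).add_const _).congr_fderiv ?_
  ext1 v
  simp only [smul_apply, add_apply,
    ContinuousLinearMap.comp_apply, LinearMap.coe_toContinuousLinearMap', Matrix.mulVecLin_apply,
    ContinuousLinearMap.id_apply, h.fderiv_ξ_apply, discMass, Matrix.smul_mulVec,
    Matrix.add_mulVec, Matrix.mulVec_mulVec, Matrix.mul_assoc]

theorem det_toContinuousLinearMap_mulVecLin (A : Matrix (Fin d) (Fin d) ℝ) :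
    (LinearMap.toContinuousLinearMap A.mulVecLin).det = A.det := by
  rw [ContinuousLinearMap.det]
  exact LinearMap.det_toLin' A

theorem IsAdmissible.measurable_discImpulse (h : S.IsAdmissible) :
    Measurable fun w : (Fin d → ℝ) × (Fin d → ℝ) => S.discImpulse w.1 w.2 := by
  have hξ := h.contDiff_ξ.continuous
  refine Measurable.add (Continuous.measurable ?_)
    ((S.measurable_gradPot.comp measurable_fst).const_smul (S.δt / 2))
  exact continuous_const.fun_smul ((continuous_const.matrix_mulVec
    (continuous_snd.sub continuous_fst)).fun_add (continuous_const.fun_smul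
      ((h.continuous_gradXi.comp continuous_fst).matrix_mulVec (continuous_const.matrix_mulVec
        ((hξ.comp continuous_snd).sub (hξ.comp continuous_fst))))))

theorem IsAdmissible.continuous_det_discMass (h : S.IsAdmissible) :
    Continuous fun w : (Fin d → ℝ) × (Fin d → ℝ) => (S.discMass w.1 w.2).det := by
  have hG := h.continuous_gradXi
  exact (continuous_const.fun_smul (continuous_const.fun_add (continuous_const.fun_smul
    (((hG.comp continuous_fst).matrix_mul continuous_const).matrix_mul
      (hG.comp continuous_snd).matrix_transpose)))).matrix_det

/-- The leapfrog step from the constrained phase space, in the variables `(p_ν, q)`. -/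
theorem IsAdmissible.isLeapfrogStep_embed_iff (h : S.IsAdmissible) (p q : Fin d → ℝ)
    (y : ExtPhase d n) : S.IsLeapfrogStep (S.embed (p, q)) y ↔
      ∃ q', S.discImpulse q q' = p ∧ y = S.embed (-S.discImpulse q' q, q') := by
  have hν := h.ν_pos.ne'
  have hδ := h.δt_pos.ne'
  have eM := Matrix.mul_nonsing_inv _ h.isUnit_det_M
  have eMz := Matrix.mul_nonsing_inv _ h.isUnit_det_Mz
  have eM' := Matrix.nonsing_inv_mul _ h.isUnit_det_M
  have eMz' := Matrix.nonsing_inv_mul _ h.isUnit_det_Mz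
  have hconj : (S.embed (p, q)).p + S.ν • (S.gradXi q *ᵥ (S.embed (p, q)).pz) = p :=
    h.conjMomentum_embed (p, q)
  constructor
  · rintro ⟨pH, pzH, lH, l, hpH, hpzH, hq, hz, hpos, hp, hpz, hmom⟩
    have hy : y = S.embed (S.conjMomentum y, y.q) := (h.embed_conjMomentum ⟨hpos, hmom⟩).symm
    have hyz : y.z = S.ν • S.ξ y.q := by
      rw [show _ = _ from hpos, smul_smul, mul_one_div_cancel hν, one_smul]
    have epH : S.M *ᵥ (y.q - q) = S.δt • pH := by
      rw [hq]
      change S.M *ᵥ (q + _ - q) = _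
      rw [add_sub_cancel_left, Matrix.mulVec_smul, Matrix.mulVec_mulVec, eM, Matrix.one_mulVec]
    have epzH : S.ν • (S.Mz *ᵥ (S.ξ y.q - S.ξ q)) = S.δt • pzH := by
      rw [← Matrix.mulVec_smul, smul_sub, ← hyz, hz]
      change S.Mz *ᵥ (S.ν • S.ξ q + _ - S.ν • S.ξ q) = _
      rw [add_sub_cancel_left, Matrix.mulVec_smul, Matrix.mulVec_mulVec, eMz, Matrix.one_mulVec]
    -- Used with `q₀ = q` for the first half step and with `q₀ = y.q` for the second; each choice
    -- cancels the multiplier of its own half step.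
    have hα : ∀ q₀ : Fin d → ℝ, (1 / S.δt) • (S.M *ᵥ (y.q - q) +
        S.ν ^ 2 • (S.gradXi q₀ *ᵥ (S.Mz *ᵥ (S.ξ y.q - S.ξ q)))) =
          pH + S.ν • (S.gradXi q₀ *ᵥ pzH) := by
      intro q₀
      rw [pow_two, mul_smul, ← Matrix.mulVec_smul (S.gradXi q₀), epH, epzH, Matrix.mulVec_smul,
        smul_comm S.ν, ← smul_add, smul_smul, one_div_mul_cancel hδ, one_smul]
    refine ⟨y.q, ?_, ?_⟩
    · rw [discImpulse, hα, hpH, hpzH]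
      refine Eq.trans ?_ hconj
      change (S.embed (p, q)).p - (S.δt / 2) • S.gradPot q - S.gradXi q *ᵥ lH + _ + _ = _
      rw [Matrix.mulVec_add, Matrix.mulVec_smul, smul_add, smul_smul, mul_one_div_cancel hν]
      module
    · have h1 : -S.discImpulse y.q q = S.conjMomentum y := by
        rw [discImpulse, ← neg_sub y.q q, ← neg_sub (S.ξ y.q), Matrix.mulVec_neg,
          Matrix.mulVec_neg, Matrix.mulVec_neg, smul_neg, ← neg_add, smul_neg, hα, conjMomentum,
          hp, hpz, Matrix.mulVec_add, Matrix.mulVec_smul, smul_add, smul_smul,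
          mul_one_div_cancel hν]
        module
      rw [h1]
      exact hy
  · rintro ⟨q', hα, rfl⟩
    set x := S.embed (p, q) with hx
    set y := S.embed (-S.discImpulse q' q, q') with hy
    have hconj' : y.p + S.ν • (S.gradXi q' *ᵥ y.pz) = -S.discImpulse q' q :=
      h.conjMomentum_embed (-S.discImpulse q' q, q')
    -- The displacements in `q` and `z` determine the half-step impulses; the `p_z` equations then
    -- determine both multipliers.
    set pH := (1 / S.δt) • (S.M *ᵥ (q' - q)) with hpH
    set pzH := (S.ν / S.δt) • (S.Mz *ᵥ (S.ξ q' - S.ξ q)) with hpzH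
    refine ⟨pH, pzH, S.ν • (pzH - x.pz), S.ν • (y.pz - pzH), ?_, ?_, ?_, ?_,
      h.posConstraint_embed _, ?_, ?_, h.momConstraint_embed _⟩
    · change pH = x.p - (S.δt / 2) • S.gradPot q - S.gradXi q *ᵥ _
      have h1 : x.p = p - S.ν • (S.gradXi q *ᵥ x.pz) := eq_sub_of_add_eq hconj
      rw [h1, ← hα, discImpulse, Matrix.mulVec_smul, Matrix.mulVec_sub (S.gradXi q), hpzH,
        hpH, Matrix.mulVec_smul]
      module
    · rw [smul_smul, one_div_mul_cancel hν]
      module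
    · change q' = q + S.δt • (S.M⁻¹ *ᵥ pH)
      rw [hpH, Matrix.mulVec_smul, Matrix.mulVec_mulVec, eM', Matrix.one_mulVec, smul_smul,
        mul_one_div_cancel hδ]
      module
    · change S.ν • S.ξ q' = S.ν • S.ξ q + S.δt • (S.Mz⁻¹ *ᵥ pzH)
      rw [hpzH, Matrix.mulVec_smul, Matrix.mulVec_mulVec, eMz', Matrix.one_mulVec, smul_smul,
        mul_div_cancel₀ _ hδ]
      module
    · change y.p = pH - (S.δt / 2) • S.gradPot q' - S.gradXi q' *ᵥ _
      have h1 : y.p = -S.discImpulse q' q - S.ν • (S.gradXi q' *ᵥ y.pz) :=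
        eq_sub_of_add_eq hconj'
      rw [h1, discImpulse, ← neg_sub q' q, ← neg_sub (S.ξ q'), Matrix.mulVec_neg,
        Matrix.mulVec_neg, Matrix.mulVec_neg, Matrix.mulVec_smul,
        Matrix.mulVec_sub (S.gradXi q'), hpzH, hpH, Matrix.mulVec_smul]
      module
    · rw [smul_smul, one_div_mul_cancel hν]
      module

/-- The relation is a projection, but the existential quantifiers can be solved: the `z` equation
gives `p_z` at the half step, the `p_z` equations give the multipliers, and these give `p` at the
half step. Measurable equations between the two endpoints remain. -/
theorem IsAdmissible.measurableSet_isLeapfrogStep (h : S.IsAdmissible) :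
    MeasurableSet {w : ExtPhase d n × ExtPhase d n | S.IsLeapfrogStep w.1 w.2} := by
  have hν := h.ν_pos.ne'
  have hδ := h.δt_pos.ne'
  have eMz := Matrix.mul_nonsing_inv _ h.isUnit_det_Mz
  have eMz' := Matrix.nonsing_inv_mul _ h.isUnit_det_Mz
  let pzH : ExtPhase d n × ExtPhase d n → (Fin n → ℝ) :=
    fun w => (1 / S.δt) • (S.Mz *ᵥ (w.2.z - w.1.z))
  let pH : ExtPhase d n × ExtPhase d n → (Fin d → ℝ) := fun w =>
    w.1.p - S.gradXi w.1.q *ᵥ (S.ν • (pzH w - w.1.pz)) - (S.δt / 2) • S.gradPot w.1.q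
  have hset : {w : ExtPhase d n × ExtPhase d n | S.IsLeapfrogStep w.1 w.2} =
      {w | w.2.q = w.1.q + S.δt • (S.M⁻¹ *ᵥ pH w)} ∩
      ({w | w.2.p = pH w - S.gradXi w.2.q *ᵥ (S.ν • (w.2.pz - pzH w)) -
          (S.δt / 2) • S.gradPot w.2.q} ∩
        Prod.snd ⁻¹' S.constrainedPhase) := by
    ext ⟨x, y⟩
    constructor
    · rintro ⟨pH', pzH', lH, l, h1, h2, hq, hz, hpos, hp, hpz, hmom⟩
      have e1 : pzH' = pzH (x, y) := by
        simp only [pzH]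
        rw [hz, add_sub_cancel_left, Matrix.mulVec_smul, Matrix.mulVec_mulVec, eMz,
          Matrix.one_mulVec, smul_smul, one_div_mul_cancel hδ, one_smul]
      have e2 : lH = S.ν • (pzH (x, y) - x.pz) := by
        rw [← e1, h2, add_sub_cancel_left, smul_smul, mul_one_div_cancel hν, one_smul]
      have e3 : l = S.ν • (y.pz - pzH (x, y)) := by
        rw [← e1, hpz, add_sub_cancel_left, smul_smul, mul_one_div_cancel hν, one_smul]
      have e4 : pH' = pH (x, y) := by
        rw [h1, e2]
        simp only [pH]
        abel
      refine ⟨?_, ?_, hpos, hmom⟩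
      · change y.q = _
        rw [hq, e4]
      · change y.p = _
        rw [hp, e4, e3]
        abel
    · rintro ⟨hq, hp, hpos, hmom⟩
      refine ⟨pH (x, y), pzH (x, y), S.ν • (pzH (x, y) - x.pz), S.ν • (y.pz - pzH (x, y)),
        ?_, ?_, hq, ?_, hpos, ?_, ?_, hmom⟩
      · simp only [pH]
        abel
      · rw [smul_smul, one_div_mul_cancel hν]
        module
      · simp only [pzH]
        rw [Matrix.mulVec_smul, Matrix.mulVec_mulVec, eMz', Matrix.one_mulVec, smul_smul,
          mul_one_div_cancel hδ]
        module
      · rw [show y.p = _ from hp]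
        abel
      · rw [smul_smul, one_div_mul_cancel hν]
        module
  have hG := h.continuous_gradXi
  have hpzH : Continuous pzH := by
    refine continuous_const.fun_smul (continuous_const.matrix_mulVec ?_)
    fun_prop
  have hg : ∀ f : ExtPhase d n × ExtPhase d n → (Fin d → ℝ), Continuous f →
      Measurable fun w => (S.δt / 2) • S.gradPot (f w) := fun f hf =>
    (S.measurable_gradPot.comp hf.measurable).const_smul (S.δt / 2)
  have hpH : Measurable pH := by
    refine Measurable.sub (Continuous.measurable ?_) (hg _ (by fun_prop))
    refine Continuous.sub (by fun_prop) ((hG.comp (by fun_prop)).matrix_mulVec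
      (continuous_const.fun_smul (hpzH.sub (by fun_prop))))
  have hMi : Measurable fun w => S.M⁻¹ *ᵥ pH w :=
    (Continuous.matrix_mulVec continuous_const continuous_id).measurable.comp hpH
  rw [hset]
  refine MeasurableSet.inter ?_ (MeasurableSet.inter ?_
    (measurable_snd h.measurableSet_constrainedPhase))
  · exact measurableSet_eq_fun (by fun_prop)
      (Measurable.add (by fun_prop) (hMi.const_smul S.δt))
  · refine measurableSet_eq_fun (by fun_prop) (Measurable.sub (hpH.sub (Continuous.measurable ?_))
      (hg _ (by fun_prop)))
    exact (hG.comp (by fun_prop)).matrix_mulVec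
      (continuous_const.fun_smul (Continuous.sub (by fun_prop) hpzH))

end IMMPData

/-! ### The Metropolis kernel and detailed balance up to a flip. -/

theorem ExtPhase.flip_flip {d n : ℕ} (x : ExtPhase d n) : x.flip.flip = x := by
  obtain ⟨q, z, p, pz⟩ := x
  simp [ExtPhase.flip, ExtPhase.q, ExtPhase.z, ExtPhase.p, ExtPhase.pz]

theorem ExtPhase.measurable_flip {d n : ℕ} :
    Measurable (ExtPhase.flip : ExtPhase d n → ExtPhase d n) := by
  have : Continuous (ExtPhase.flip : ExtPhase d n → ExtPhase d n) := by
    unfold ExtPhase.flip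
    fun_prop
  exact this.measurable

namespace IMMPData

variable {d n : ℕ} {S : IMMPData d n} {D : Set (ExtPhase d n)}

theorem IsSolvabilityDomain.isLeapfrogStep_leapfrog (hD : S.IsSolvabilityDomain D)
    {x : ExtPhase d n} (hx : x ∈ D) : S.IsLeapfrogStep x (S.leapfrog x) :=
  Classical.epsilon_spec (hD.existsUnique x hx).exists

theorem IsSolvabilityDomain.leapfrog_eq (hD : S.IsSolvabilityDomain D)
    {x y : ExtPhase d n} (hx : x ∈ D) (hy : S.IsLeapfrogStep x y) : S.leapfrog x = y :=
  (hD.existsUnique x hx).unique (hD.isLeapfrogStep_leapfrog hx) hy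

theorem IsSolvabilityDomain.flip_mem_iff (hD : S.IsSolvabilityDomain D) (x : ExtPhase d n) :
    x.flip ∈ D ↔ x ∈ D :=
  ⟨fun h => by simpa [ExtPhase.flip_flip] using hD.flip_mem _ h, hD.flip_mem x⟩

/-- The states at which the leapfrog step can be performed within `D`. -/
def moveSet (S : IMMPData d n) (D : Set (ExtPhase d n)) : Set (ExtPhase d n) :=
  {x | x ∈ D ∧ S.leapfrog x ∈ D}

open Classical in
/-- The leapfrog map on `D`, extended by the identity. -/
noncomputable def leapfrogOn (S : IMMPData d n) (D : Set (ExtPhase d n)) :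
    ExtPhase d n → ExtPhase d n :=
  D.piecewise S.leapfrog id

theorem leapfrogOn_of_mem {x : ExtPhase d n} (hx : x ∈ D) : S.leapfrogOn D x = S.leapfrog x := by
  simp [leapfrogOn, hx]

/-- Off `D` the value of `leapfrog` is an arbitrary choice, so measurability is sought on `D` only;
`leapfrogOn` replaces the rest by the identity. -/
theorem IsAdmissible.measurableSet_inter_leapfrog (h : S.IsAdmissible)
    (hD : S.IsSolvabilityDomain D) {B : Set (ExtPhase d n)} (hB : MeasurableSet B) :
    MeasurableSet (D ∩ S.leapfrog ⁻¹' B) :=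
  measurableSet_inter_preimage_of_existsUnique (r := S.IsLeapfrogStep)
    h.measurableSet_isLeapfrogStep hD.measurableSet hD.existsUnique
    (fun _ hx => hD.isLeapfrogStep_leapfrog hx) hB

theorem IsAdmissible.measurableSet_moveSet (h : S.IsAdmissible) (hD : S.IsSolvabilityDomain D) :
    MeasurableSet (S.moveSet D) :=
  h.measurableSet_inter_leapfrog hD hD.measurableSet

theorem IsAdmissible.measurable_leapfrogOn (h : S.IsAdmissible) (hD : S.IsSolvabilityDomain D) :
    Measurable (S.leapfrogOn D) := by
  intro B hB
  rw [leapfrogOn, Set.piecewise_preimage, Set.ite]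
  refine MeasurableSet.union ?_ (MeasurableSet.diff (measurable_id hB) hD.measurableSet)
  rw [Set.inter_comm]
  exact h.measurableSet_inter_leapfrog hD hB

/-- The acceptance probability of the move proposed at a state. -/
noncomputable def accept (S : IMMPData d n) (D : Set (ExtPhase d n)) (x : ExtPhase d n) : ℝ :=
  S.acceptProb x (S.leapfrogOn D x)

theorem IsAdmissible.measurable_accept (h : S.IsAdmissible) (hD : S.IsSolvabilityDomain D) :
    Measurable (S.accept D) := by
  have hH := h.continuous_hamiltonian.measurable
  have h1 : Measurable fun x => -S.β * (S.hamiltonian (S.leapfrogOn D x) - S.hamiltonian x) :=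
    ((hH.comp (h.measurable_leapfrogOn hD)).sub hH).const_mul _
  exact measurable_const.min (Real.measurable_exp.comp h1)

theorem accept_nonneg (x : ExtPhase d n) : 0 ≤ S.accept D x :=
  le_min zero_le_one (Real.exp_pos _).le

theorem accept_le_one (x : ExtPhase d n) : S.accept D x ≤ 1 := min_le_left _ _

theorem metropolisLaw_of_mem {x : ExtPhase d n} (hx : x ∈ S.moveSet D) :
    S.metropolisLaw D x = ENNReal.ofReal (S.accept D x) • Measure.dirac (S.leapfrogOn D x) +
      ENNReal.ofReal (1 - S.accept D x) • Measure.dirac x.flip := by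
  rw [metropolisLaw, if_pos (show x ∈ D ∧ S.leapfrog x ∈ D from hx), accept, leapfrogOn_of_mem hx.1]

theorem metropolisLaw_of_notMem {x : ExtPhase d n} (hx : x ∉ S.moveSet D) :
    S.metropolisLaw D x = Measure.dirac x.flip := by
  rw [metropolisLaw, if_neg (show ¬ (x ∈ D ∧ S.leapfrog x ∈ D) from hx)]

theorem ofReal_accept_add (x : ExtPhase d n) :
    ENNReal.ofReal (S.accept D x) + ENNReal.ofReal (1 - S.accept D x) = 1 := by
  rw [← ENNReal.ofReal_add (accept_nonneg x) (sub_nonneg.2 (accept_le_one x))]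
  simp

open Classical in
/-- Steps 1 and 2 of the scheme as a Markov kernel. -/
noncomputable def IsAdmissible.metropolisKernel (h : S.IsAdmissible)
    (hD : S.IsSolvabilityDomain D) : Kernel (ExtPhase d n) (ExtPhase d n) where
  toFun := S.metropolisLaw D
  measurable' := by
    refine Measure.measurable_of_measurable_coe _ fun B hB => ?_
    have h1 : Measurable (fun x => S.metropolisLaw D x B) ↔ Measurable fun x =>
        if x ∈ S.moveSet D then
          ENNReal.ofReal (S.accept D x) * B.indicator 1 (S.leapfrogOn D x) +
            ENNReal.ofReal (1 - S.accept D x) * B.indicator 1 x.flip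
        else B.indicator 1 x.flip := by
      refine iff_of_eq (congrArg _ (funext fun x => ?_))
      split_ifs with hx
      · simp [metropolisLaw_of_mem hx, hB]
      · simp [metropolisLaw_of_notMem hx, hB]
    rw [h1]
    have ha := h.measurable_accept hD
    have hB' : Measurable (B.indicator (1 : ExtPhase d n → ℝ≥0∞)) := measurable_one.indicator hB
    exact Measurable.ite (h.measurableSet_moveSet hD)
      ((ha.ennreal_ofReal.mul (hB'.comp (h.measurable_leapfrogOn hD))).add
        ((measurable_const.sub ha).ennreal_ofReal.mul (hB'.comp ExtPhase.measurable_flip)))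
      (hB'.comp ExtPhase.measurable_flip)

theorem IsAdmissible.metropolisKernel_apply (h : S.IsAdmissible)
    (hD : S.IsSolvabilityDomain D) (x : ExtPhase d n) :
    h.metropolisKernel hD x = S.metropolisLaw D x := rfl

instance IsAdmissible.isMarkovKernel_metropolisKernel (h : S.IsAdmissible)
    (hD : S.IsSolvabilityDomain D) : IsMarkovKernel (h.metropolisKernel hD) := by
  refine ⟨fun x => ⟨?_⟩⟩
  rw [h.metropolisKernel_apply]
  by_cases hx : x ∈ S.moveSet D
  · rw [metropolisLaw_of_mem hx]
    simp only [Measure.add_apply, Measure.smul_apply, measure_univ, smul_eq_mul, mul_one,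
      ofReal_accept_add]
  · rw [metropolisLaw_of_notMem hx, measure_univ]

/-- The Metropolis law only charges the flipped state and the proposal. -/
theorem metropolisLaw_apply_eq_zero {B : Set (ExtPhase d n)} (hB : MeasurableSet B)
    {x : ExtPhase d n} (hflip : x.flip ∉ B) (hmove : x ∈ S.moveSet D → S.leapfrog x ∉ B) :
    S.metropolisLaw D x B = 0 := by
  by_cases hx : x ∈ S.moveSet D
  · rw [metropolisLaw_of_mem hx, leapfrogOn_of_mem hx.1]
    simp only [Measure.add_apply, Measure.smul_apply, Measure.dirac_apply' _ hB,
      Set.indicator_of_notMem hflip, Set.indicator_of_notMem (hmove hx), smul_zero, add_zero]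
  · rw [metropolisLaw_of_notMem hx, Measure.dirac_apply' _ hB, Set.indicator_of_notMem hflip]

theorem IsAdmissible.map_flip_extCanonical (h : S.IsAdmissible) :
    S.extCanonical.map ExtPhase.flip = S.extCanonical := by
  refine Measure.ext_of_lintegral _ fun f hf => ?_
  have hfE : Measurable fun y => f (S.embed y) := hf.comp h.continuous_embed.measurable
  have hfE' : Measurable fun y => f (S.embed y).flip :=
    hf.comp (ExtPhase.measurable_flip.comp h.continuous_embed.measurable)
  rw [lintegral_map hf ExtPhase.measurable_flip,
    h.lintegral_extCanonical (f := fun x => f x.flip) (hf.comp ExtPhase.measurable_flip),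
    h.lintegral_extCanonical hf, h.lintegral_penWeight_mul hfE, h.lintegral_penWeight_mul hfE']
  congr 1
  refine lintegral_congr fun q => ?_
  rw [← lintegral_neg_eq_self]
  refine lintegral_congr fun p => ?_
  rw [penWeight, penWeight, penHamiltonian_neg, flip_embed]
  simp

/-- The Metropolis kernel leaves invariant a flip-invariant measure that satisfies the detailed
balance up to a flip. -/
theorem IsAdmissible.invariant_metropolisKernel_of_balance (h : S.IsAdmissible)
    (hD : S.IsSolvabilityDomain D) {m : Measure (ExtPhase d n)}
    (hflip : m.map ExtPhase.flip = m)
    (hbal : ∀ f : ExtPhase d n → ℝ≥0∞, Measurable f →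
      ∫⁻ x in S.moveSet D, ENNReal.ofReal (S.accept D x) * f (S.leapfrogOn D x) ∂m =
        ∫⁻ x in S.moveSet D, ENNReal.ofReal (S.accept D x) * f x.flip ∂m) :
    (h.metropolisKernel hD).Invariant m := by
  have hE := h.measurableSet_moveSet hD
  have ha := h.measurable_accept hD
  refine Measure.ext_of_lintegral _ fun f hf => ?_
  have hff : Measurable fun x : ExtPhase d n => f x.flip := hf.comp ExtPhase.measurable_flip
  rw [Measure.lintegral_bind (Kernel.aemeasurable _) hf.aemeasurable]
  calc ∫⁻ x, ∫⁻ y, f y ∂(h.metropolisKernel hD x) ∂m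
      = ∫⁻ x in S.moveSet D, ∫⁻ y, f y ∂(S.metropolisLaw D x) ∂m +
          ∫⁻ x in (S.moveSet D)ᶜ, ∫⁻ y, f y ∂(S.metropolisLaw D x) ∂m :=
        (lintegral_add_compl _ hE).symm
    _ = ∫⁻ x in S.moveSet D, (ENNReal.ofReal (S.accept D x) * f (S.leapfrogOn D x) +
          ENNReal.ofReal (1 - S.accept D x) * f x.flip) ∂m +
          ∫⁻ x in (S.moveSet D)ᶜ, f x.flip ∂m := by
        congr 1
        · refine setLIntegral_congr_fun hE fun x hx => ?_
          simp [metropolisLaw_of_mem hx, lintegral_dirac' _ hf]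
        · refine setLIntegral_congr_fun hE.compl fun x hx => ?_
          simp [metropolisLaw_of_notMem hx, lintegral_dirac' _ hf]
    -- The balance replaces the accepted moves by flips of the same weight, which complete the
    -- rejected part to total mass one.
    _ = ∫⁻ x in S.moveSet D, f x.flip ∂m + ∫⁻ x in (S.moveSet D)ᶜ, f x.flip ∂m := by
        congr 1
        have ha' : Measurable fun x => ENNReal.ofReal (1 - S.accept D x) * f x.flip :=
          (measurable_const.sub ha).ennreal_ofReal.mul hff
        rw [lintegral_add_right _ ha', hbal f hf,
          ← lintegral_add_left (ha.ennreal_ofReal.fun_mul hff)]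
        refine lintegral_congr fun x => ?_
        rw [← add_mul, ofReal_accept_add, one_mul]
    _ = ∫⁻ x, f x.flip ∂m := lintegral_add_compl _ hE
    _ = ∫⁻ x, f x ∂m := by
        rw [← lintegral_map hf ExtPhase.measurable_flip, hflip]

/-- Time reversibility: exchanging `q` and `q'` shows that leapfrog followed by a flip is an
involution where it is defined within `D`. -/
theorem IsAdmissible.leapfrog_embed (h : S.IsAdmissible) (hD : S.IsSolvabilityDomain D)
    {q q' : Fin d → ℝ} (hx : S.embed (S.discImpulse q q', q) ∈ D) :
    S.leapfrog (S.embed (S.discImpulse q q', q)) =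
      (S.embed (S.discImpulse q' q, q')).flip := by
  rw [flip_embed]
  exact hD.leapfrog_eq hx ((h.isLeapfrogStep_embed_iff _ _ _).2 ⟨q', rfl, rfl⟩)

theorem IsAdmissible.embed_mem_moveSet (h : S.IsAdmissible) (hD : S.IsSolvabilityDomain D)
    {q q' : Fin d → ℝ} (hx : S.embed (S.discImpulse q q', q) ∈ S.moveSet D) :
    S.embed (S.discImpulse q' q, q') ∈ S.moveSet D := by
  obtain ⟨h1, h2⟩ := hx
  rw [h.leapfrog_embed hD h1, hD.flip_mem_iff] at h2
  refine ⟨h2, ?_⟩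
  rw [h.leapfrog_embed hD h2, hD.flip_mem_iff]
  exact h1

/-- Both sides are `min (exp (-β H_ν(y))) (exp (-β H_ν(y')))`, because the Hamiltonian is even in
the impulses. -/
theorem IsAdmissible.penWeight_mul_acceptProb (h : S.IsAdmissible)
    (y y' : (Fin d → ℝ) × (Fin d → ℝ)) :
    S.penWeight y * ENNReal.ofReal (S.acceptProb (S.embed y) (S.embed y').flip) =
      S.penWeight y' * ENNReal.ofReal (S.acceptProb (S.embed y') (S.embed y).flip) := by
  have key : ∀ y y' : (Fin d → ℝ) × (Fin d → ℝ),
      S.penWeight y * ENNReal.ofReal (S.acceptProb (S.embed y) (S.embed y').flip) =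
        ENNReal.ofReal (min (Real.exp (-S.β * S.penHamiltonian y.1 y.2))
          (Real.exp (-S.β * S.penHamiltonian y'.1 y'.2))) := by
    intro y y'
    rw [penWeight, ← ENNReal.ofReal_mul (Real.exp_pos _).le, acceptProb, hamiltonian_flip,
      h.hamiltonian_embed, h.hamiltonian_embed, mul_min_of_nonneg _ _ (Real.exp_pos _).le,
      mul_one, ← Real.exp_add]
    congr 3
    ring
  rw [key, key, min_comm]

theorem IsAdmissible.balance_extCanonical (h : S.IsAdmissible) (hD : S.IsSolvabilityDomain D)
    {f : ExtPhase d n → ℝ≥0∞} (hf : Measurable f) :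
    ∫⁻ x in S.moveSet D, ENNReal.ofReal (S.accept D x) * f (S.leapfrogOn D x) ∂S.extCanonical =
      ∫⁻ x in S.moveSet D, ENNReal.ofReal (S.accept D x) * f x.flip ∂S.extCanonical := by
  have hE := h.measurableSet_moveSet hD
  have ha := (h.measurable_accept hD).ennreal_ofReal
  have hemb := h.continuous_embed.measurable
  have hpull : ∀ g : ExtPhase d n → ℝ≥0∞, Measurable g →
      ∫⁻ x in S.moveSet D, g x ∂S.extCanonical = (S.gaussConst * S.posZ)⁻¹ *
        ∫⁻ y in S.embed ⁻¹' S.moveSet D, S.penWeight y * g (S.embed y) := by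
    intro g hg
    rw [← lintegral_indicator hE, h.lintegral_extCanonical (hg.indicator hE),
      ← lintegral_indicator (hemb hE)]
    congr 1
    refine lintegral_congr fun y => ?_
    by_cases hy : S.embed y ∈ S.moveSet D
    · rw [Set.indicator_of_mem hy, Set.indicator_of_mem (by exact hy)]
    · rw [Set.indicator_of_notMem hy, Set.indicator_of_notMem (by exact hy), mul_zero]
  have hg1 : Measurable fun x => ENNReal.ofReal (S.accept D x) * f (S.leapfrogOn D x) :=
    ha.mul (hf.comp (h.measurable_leapfrogOn hD))
  have hg2 : Measurable fun x : ExtPhase d n => ENNReal.ofReal (S.accept D x) * f x.flip :=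
    ha.mul (hf.comp ExtPhase.measurable_flip)
  rw [hpull _ hg1, hpull _ hg2]
  congr 1
  refine setLIntegral_eq_of_symmetric_generating h.hasFDerivAt_discImpulse
    h.measurable_discImpulse ?_ ?_ (hemb hE) ?_ (fun q q' => h.embed_mem_moveSet hD)
    (h.measurable_penWeight.mul (hg1.comp hemb)) (h.measurable_penWeight.mul (hg2.comp hemb)) ?_
  · simp only [det_toContinuousLinearMap_mulVecLin]
    exact h.continuous_det_discMass.measurable
  · intro q q'
    simp only [det_toContinuousLinearMap_mulVecLin]
    exact h.det_discMass_comm q q'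
  -- Uniqueness of the full leapfrog step passes to its end position, which solves `discImpulse q q'
  -- = p`.
  · rintro ⟨p, q⟩ hy
    obtain ⟨y', hy', -⟩ := hD.existsUnique _ hy.1
    obtain ⟨q', hq', -⟩ := (h.isLeapfrogStep_embed_iff p q y').1 hy'
    refine ⟨q', hq', fun q'' hq'' => ?_⟩
    have h1 := (hD.existsUnique _ hy.1).unique
      ((h.isLeapfrogStep_embed_iff p q _).2 ⟨q', hq', rfl⟩)
      ((h.isLeapfrogStep_embed_iff p q _).2 ⟨q'', hq'', rfl⟩)
    exact (congrArg Prod.fst h1).symm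
  · intro q q' hx
    have hx' := h.embed_mem_moveSet hD hx
    simp only [accept, leapfrogOn_of_mem hx.1, leapfrogOn_of_mem hx'.1,
      h.leapfrog_embed hD hx.1, h.leapfrog_embed hD hx'.1]
    rw [← mul_assoc, ← mul_assoc, h.penWeight_mul_acceptProb]

theorem IsAdmissible.invariant_metropolisKernel (h : S.IsAdmissible)
    (hD : S.IsSolvabilityDomain D) : (h.metropolisKernel hD).Invariant S.extCanonical :=
  h.invariant_metropolisKernel_of_balance hD h.map_flip_extCanonical
    fun _ hf => h.balance_extCanonical hD hf

theorem IsAdmissible.invariant_metropolisKernel_restrict (h : S.IsAdmissible)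
    (hD : S.IsSolvabilityDomain D) :
    (h.metropolisKernel hD).Invariant (S.extCanonical.restrict D) := by
  refine h.invariant_metropolisKernel_of_balance hD ?_ fun f hf => ?_
  · have hpre : ExtPhase.flip ⁻¹' D = D := Set.ext hD.flip_mem_iff
    conv_lhs => rw [← hpre]
    rw [← Measure.restrict_map ExtPhase.measurable_flip hD.measurableSet, h.map_flip_extCanonical]
  · have hsub : S.moveSet D ∩ D = S.moveSet D := Set.inter_eq_left.2 fun x hx => hx.1
    rw [Measure.restrict_restrict (h.measurableSet_moveSet hD), hsub]
    exact h.balance_extCanonical hD hf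

/-! ### Restriction and conditioning to `D`. -/

/-- Step 3 restricted to `D` as a Markov kernel. -/
noncomputable def IsAdmissible.restrictedThermostatKernel (h : S.IsAdmissible)
    (hD : MeasurableSet D) : Kernel (ExtPhase d n) (ExtPhase d n) where
  toFun := S.restrictedThermostatLaw D
  measurable' := by
    refine Measure.measurable_of_measurable_coe _ fun B hB => ?_
    have h1 : (fun x => S.restrictedThermostatLaw D x B) = fun x =>
        h.thermostatKernel x (B ∩ D) + h.thermostatKernel x Dᶜ * B.indicator 1 x := by
      funext x
      simp [restrictedThermostatLaw, h.thermostatKernel_apply, Measure.restrict_apply hB, hB]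
    rw [h1]
    exact (h.thermostatKernel.measurable_coe (hB.inter hD)).add
      ((h.thermostatKernel.measurable_coe hD.compl).mul (measurable_one.indicator hB))

theorem IsAdmissible.restrictedThermostatKernel_apply (h : S.IsAdmissible)
    (hD : MeasurableSet D) (x : ExtPhase d n) :
    h.restrictedThermostatKernel hD x = S.restrictedThermostatLaw D x := rfl

theorem IsAdmissible.restrictedThermostatKernel_apply_apply (h : S.IsAdmissible)
    (hD : MeasurableSet D) (x : ExtPhase d n) {B : Set (ExtPhase d n)} (hB : MeasurableSet B) :
    h.restrictedThermostatKernel hD x B =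
      h.thermostatKernel x (B ∩ D) + h.thermostatKernel x Dᶜ * B.indicator 1 x := by
  simp [h.restrictedThermostatKernel_apply, restrictedThermostatLaw, h.thermostatKernel_apply,
    Measure.restrict_apply hB, hB]

instance IsAdmissible.isMarkovKernel_restrictedThermostatKernel (h : S.IsAdmissible)
    (hD : MeasurableSet D) : IsMarkovKernel (h.restrictedThermostatKernel hD) := by
  refine ⟨fun x => ⟨?_⟩⟩
  rw [h.restrictedThermostatKernel_apply_apply hD x .univ]
  simp [measure_add_measure_compl hD]

/-- By reversibility, the mass that `D` sends into `B ∩ D` equals the mass that `B ∩ D` sends into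
`D`. Rejection keeps in place the mass that `B ∩ D` would send out of `D`, and the two add up to the
mass of `B ∩ D`. -/
theorem IsAdmissible.invariant_restrictedThermostatKernel (h : S.IsAdmissible)
    (hD : MeasurableSet D) :
    (h.restrictedThermostatKernel hD).Invariant (S.extCanonical.restrict D) := by
  refine Measure.ext fun B hB => ?_
  have hBD := hB.inter hD
  have hR := h.thermostatKernel.measurable_coe hD
  rw [Measure.bind_apply hB (Kernel.aemeasurable _), Measure.restrict_apply hB]
  simp only [h.restrictedThermostatKernel_apply_apply hD _ hB]
  rw [lintegral_add_left (h.thermostatKernel.measurable_coe hBD),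
    h.isReversible_thermostatKernel hD hBD]
  have h2 : ∫⁻ x in D, h.thermostatKernel x Dᶜ * B.indicator 1 x ∂S.extCanonical =
      ∫⁻ x in B ∩ D, h.thermostatKernel x Dᶜ ∂S.extCanonical := by
    rw [← Measure.restrict_restrict hB, ← lintegral_indicator hB]
    refine lintegral_congr fun x => ?_
    by_cases hx : x ∈ B <;> simp [hx]
  rw [h2, ← lintegral_add_left hR]
  simp only [measure_add_measure_compl hD, measure_univ, lintegral_const, one_mul,
    Measure.restrict_apply_univ]

theorem IsAdmissible.invariant_thermostatKernel_restrict (h : S.IsAdmissible)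
    (hD : MeasurableSet D) (hstay : ∀ᵐ x ∂S.extCanonical, x ∈ D → h.thermostatKernel x Dᶜ = 0) :
    h.thermostatKernel.Invariant (S.extCanonical.restrict D) := by
  have hinv := h.invariant_restrictedThermostatKernel hD
  refine Measure.ext fun B hB => ?_
  conv_rhs => rw [← hinv.def]
  rw [Measure.bind_apply hB (Kernel.aemeasurable _), Measure.bind_apply hB (Kernel.aemeasurable _)]
  refine lintegral_congr_ae ((ae_restrict_iff' hD).2 (hstay.mono fun x hx hxD => ?_))
  have h0 := hx hxD
  change h.thermostatKernel x B = h.restrictedThermostatKernel hD x B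
  rw [h.restrictedThermostatKernel_apply_apply hD x hB, h0, zero_mul, add_zero,
    ← measure_inter_add_sdiff B hD]
  have h1 : h.thermostatKernel x (B \ D) = 0 := measure_mono_null (fun y hy => hy.2) h0
  rw [h1, add_zero]

/-- Conditioning only rescales the restriction, and invariance is linear in the measure. If `D` is
null, both measures are zero, so that case needs no separate treatment. -/
theorem Invariant.cond {κ : Kernel (ExtPhase d n) (ExtPhase d n)} {m : Measure (ExtPhase d n)}
    (hκ : κ.Invariant (m.restrict D)) : κ.Invariant (m[|D]) := by
  rw [ProbabilityTheory.cond, Kernel.Invariant, Measure.comp_smul, hκ.def]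

theorem comp_apply_eq_zero {κ η : Kernel (ExtPhase d n) (ExtPhase d n)}
    {B : Set (ExtPhase d n)} (hB : MeasurableSet B) {x : ExtPhase d n} (hη : η x B = 0)
    (hκ : ∀ y ∉ B, κ y B = 0) : (κ ∘ₖ η) x B = 0 := by
  rw [Kernel.comp_apply' _ _ _ hB, lintegral_eq_zero_iff (κ.measurable_coe hB)]
  have h1 : ∀ᵐ y ∂(η x), y ∉ B := by simpa [ae_iff] using hη
  exact h1.mono fun y hy => hκ y hy

theorem IsAdmissible.map_q_extCanonical (h : S.IsAdmissible) :
    S.extCanonical.map ExtPhase.q = positionCanonical S.β S.V := by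
  rw [← h.map_snd_penCanonical, extCanonical,
    Measure.map_map measurable_fst h.continuous_embed.measurable]
  rfl

theorem IsAdmissible.comp_apply_compl_constrainedPhase (h : S.IsAdmissible)
    (hD : S.IsSolvabilityDomain D) {x : ExtPhase d n} (hx : x ∈ S.constrainedPhase) :
    (h.thermostatKernel ∘ₖ h.metropolisKernel hD) x S.constrainedPhaseᶜ = 0 := by
  have hC := h.measurableSet_constrainedPhase
  refine comp_apply_eq_zero hC.compl (metropolisLaw_apply_eq_zero hC.compl ?_ ?_) ?_
  · have h1 : x.flip ∈ S.constrainedPhase := by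
      rw [← h.embed_conjMomentum hx, flip_embed]
      exact h.embed_mem _
    exact not_not.2 h1
  · intro hm
    -- Both constraints at the endpoint are among the equations of the step.
    obtain ⟨_, _, _, _, _, _, _, _, hpos, _, _, hmom⟩ := hD.isLeapfrogStep_leapfrog hm.1
    exact not_not.2 ⟨hpos, hmom⟩
  · intro y hy
    rw [Set.notMem_compl_iff] at hy
    rw [h.thermostatKernel_apply, h.thermostatLaw_apply _ hC.compl]
    convert measure_empty (μ := noise d n)
    refine Set.eq_empty_of_forall_notMem fun u hu => hu ⟨hy.1, ?_⟩
    exact (h.momConstraint_iff _).2 ⟨_, rfl, rfl⟩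

theorem IsAdmissible.restricted_comp_apply_compl (h : S.IsAdmissible)
    (hD : S.IsSolvabilityDomain D) {x : ExtPhase d n} (hx : x ∈ D) :
    (h.restrictedThermostatKernel hD.measurableSet ∘ₖ h.metropolisKernel hD) x Dᶜ = 0 := by
  have hDc := hD.measurableSet.compl
  refine comp_apply_eq_zero hDc (metropolisLaw_apply_eq_zero hDc ?_ ?_) ?_
  · simpa using hD.flip_mem x hx
  · exact fun hm => by simpa using hm.2
  · intro y hy
    rw [h.restrictedThermostatKernel_apply_apply _ _ hDc]
    simp [hy]

end IMMPData

/-! ### Exact sampling. -/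

theorem mainTheorem5 {d n : ℕ} (S : IMMPData d n)
    (hM : S.M.PosDef) (hMz : S.Mz.PosDef)
    (hV : ContDiff ℝ 1 S.V) (hξ : ContDiff ℝ 2 S.ξ)
    (hβ : 0 < S.β) (hν : 0 < S.ν) (hδt : 0 < S.δt)
    (hγ : S.γ.PosSemidef) (hγz : S.γz.PosSemidef)
    (hσ : S.σ * S.σᵀ = (2 / S.β) • S.γ) (hσz : S.σz * S.σzᵀ = (2 / S.β) • S.γz)
    (hZ : Integrable (fun q => Real.exp (-S.β * S.V q)) volume)
    (D : Set (ExtPhase d n)) (hD : S.IsSolvabilityDomain D) :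
    -- the penalized canonical distribution is a probability distribution
    IsProbabilityMeasure S.penCanonical ∧
    -- Step 3 is well posed
    (∀ x u, ∃! y, S.IsMidpointStep x u y) ∧
    -- Steps 1-2 and Step 3 are Markov kernels `Q` and `R`; the chain has the kernel `R ∘ₖ Q`
    (∃ Q R : Kernel (ExtPhase d n) (ExtPhase d n),
      IsMarkovKernel Q ∧ IsMarkovKernel R ∧
      (∀ x, Q x = S.metropolisLaw D x) ∧ (∀ x, R x = S.thermostatLaw x) ∧
      -- the chain satisfies the constraints for ever
      (∀ x ∈ S.constrainedPhase, (R ∘ₖ Q) x S.constrainedPhaseᶜ = 0) ∧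
      -- the chain leaves the canonical distribution invariant
      (R ∘ₖ Q).Invariant S.extCanonical ∧
      -- Steps 1-2 leave its conditioning to `D` invariant, and so does the chain if Step 3 does not
      -- leave `D`
      Q.Invariant (S.extCanonical[|D]) ∧
      ((∀ᵐ x ∂S.extCanonical, x ∈ D → R x Dᶜ = 0) →
        (R ∘ₖ Q).Invariant (S.extCanonical[|D])) ∧
      -- in general, the chain restricted to `D` stays in `D` and leaves the conditioning invariant
      ∃ R' : Kernel (ExtPhase d n) (ExtPhase d n),
        IsMarkovKernel R' ∧ (∀ x, R' x = S.restrictedThermostatLaw D x) ∧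
        (∀ x ∈ D, (R' ∘ₖ Q) x Dᶜ = 0) ∧
        (R' ∘ₖ Q).Invariant (S.extCanonical[|D])) ∧
    -- the position marginal, which does not depend on `ν`
    S.penCanonical.map Prod.snd = positionCanonical S.β S.V ∧
    S.extCanonical.map ExtPhase.q = positionCanonical S.β S.V := by
  have h : S.IsAdmissible := ⟨hM, hMz, hV, hξ, hβ, hν, hδt, hγ, hγz, hσ, hσz⟩
  have hQ := IMMPData.Invariant.cond (h.invariant_metropolisKernel_restrict hD)
  refine ⟨h.isProbabilityMeasure_penCanonical hZ, h.existsUnique_isMidpointStep,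
    ⟨h.metropolisKernel hD, h.thermostatKernel, inferInstance, inferInstance, fun _ => rfl,
      fun _ => rfl, fun x hx => h.comp_apply_compl_constrainedPhase hD hx,
      h.isReversible_thermostatKernel.invariant.comp (h.invariant_metropolisKernel hD), hQ,
      fun hstay => (IMMPData.Invariant.cond
        (h.invariant_thermostatKernel_restrict hD.measurableSet hstay)).comp hQ,
      h.restrictedThermostatKernel hD.measurableSet, inferInstance, fun _ => rfl,
      fun x hx => h.restricted_comp_apply_compl hD hx,
      (IMMPData.Invariant.cond
        (h.invariant_restrictedThermostatKernel hD.measurableSet)).comp hQ⟩,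
    h.map_snd_penCanonical, h.map_q_extCanonical⟩
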